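/- Let $k\in\{3,4,6\}$, let $\zeta_k\in\mathbb{C}$ be a primitive $k$-th root of unity and let $R=\mathbb{Z}[\zeta_k]$. A Hermitian lattice over $R$ is a finitely generated free $R$-module $\Lambda$ with an $R$-valued Hermitian pairing $\star$ (linear in the second variable, conjugate-linear in the first). It is called $\alpha$-modular if $\Lambda=\alpha\Lambda^\vee$ inside $\Lambda\otimes_R\mathbb{C}$, where $\Lambda^\vee=\{w\in\Lambda\otimes_R\mathbb{C}: w\star y\in R\text{ for all }y\in\Lambda\}$ is the Hermitian dual. $U(\Lambda)$ denotes the group of $R$-linear automorphisms of $\Lambda$ preserving $\star$. A vector $e\in\Lambda$ is primitive if $e=ax$ with $a\in R$, $x\in\Lambda$ implies that $a$ is a unit (so $e\neq 0$), and isotropic if $e\star e=0$. Proposition. Let $s\ge 1$ and let $\Lambda$ be a $(1+\zeta_k)$-modular Hermitian lattice over $\mathbb{Z}[\zeta_k]$ of signature $(1,s)$. For every primitive isotropic vector $e\in\Lambda$, the module $e^\perp/\mathbb{Z}[\zeta_k]e$ with the pairing induced by $\star$ is a negative definite $(1+\zeta_k)$-modular Hermitian lattice over $\mathbb{Z}[\zeta_k]$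 of rank $s-1$. The assignment $e\mapsto e^\perp/e$ induces a bijection from the set of $U(\Lambda)$-orbits of primitive isotropic vectors in $\Lambda$ to the set of isometry classes of negative definite $(1+\zeta_k)$-modular Hermitian lattices over $\mathbb{Z}[\zeta_k]$ of rank $s-1$. -/

import Mathlib

open scoped TensorProduct ComplexConjugate

universe u v w

namespace HermLat

/-- The ring `ℤ[ζ]`, as a subring of `ℂ`. -/
abbrev CycInt (ζ : ℂ) : Subalgebra ℤ ℂ := Algebra.adjoin ℤ {ζ}

/-- A Hermitian pairing on an `R`-module `V` with values in the ring `R ⊆ ℂ`: linear in the second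
variable, with `x ⋆ y` the complex conjugate of `y ⋆ x` (so conjugate-linear in the first). -/
structure HermitianForm (R : Subalgebra ℤ ℂ) (V : Type u) [AddCommGroup V] [Module R V] where
  toFun : V → V →ₗ[R] R
  conj_symm : ∀ x y : V, conj (toFun y x : ℂ) = (toFun x y : ℂ)

section Form

variable {R : Subalgebra ℤ ℂ} {V : Type u} [AddCommGroup V] [Module R V]

instance : CoeFun (HermitianForm R V) (fun _ => V → V →ₗ[R] R) := ⟨HermitianForm.toFun⟩

theorem HermitianForm.map_add_left (h : HermitianForm R V) (x y z : V) :
    h (x + y) z = h x z + h y z := by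
  apply Subtype.ext
  push_cast
  rw [← h.conj_symm (x + y) z, ← h.conj_symm x z, ← h.conj_symm y z, map_add]
  push_cast
  rw [map_add]

theorem HermitianForm.coe_smul_left (h : HermitianForm R V) (a : R) (x z : V) :
    (h (a • x) z : ℂ) = conj (a : ℂ) * (h x z : ℂ) := by
  rw [← h.conj_symm (a • x) z, ← h.conj_symm x z, map_smul, smul_eq_mul]
  push_cast
  rw [map_mul]

/-- For `x` in the lattice, the `ℂ`-linear extension of `x ⋆ ·` to `V ⊗ ℂ`. -/
noncomputable def HermitianForm.extendRight (h : HermitianForm R V) (x : V) :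
    ℂ ⊗[R] V →ₗ[ℂ] ℂ :=
  (TensorProduct.AlgebraTensorModule.rid R ℂ ℂ).toLinearMap ∘ₗ (h x).baseChange ℂ

theorem HermitianForm.extendRight_tmul (h : HermitianForm R V) (x y : V) (c : ℂ) :
    h.extendRight x (c ⊗ₜ y) = c * (h x y : ℂ) := by
  simp [HermitianForm.extendRight, Algebra.smul_def, mul_comm]

theorem HermitianForm.extendRight_add (h : HermitianForm R V) (x y : V) (w : ℂ ⊗[R] V) :
    h.extendRight (x + y) w = h.extendRight x w + h.extendRight y w := by
  induction w using TensorProduct.induction_on with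
  | zero => simp
  | tmul c z => simp only [extendRight_tmul, map_add_left]; push_cast; ring
  | add a b ha hb => rw [map_add, map_add, map_add, ha, hb]; ring

theorem HermitianForm.extendRight_smul (h : HermitianForm R V) (a : R) (x : V) (w : ℂ ⊗[R] V) :
    h.extendRight (a • x) w = conj (a : ℂ) * h.extendRight x w := by
  induction w using TensorProduct.induction_on with
  | zero => simp
  | tmul c z => simp only [extendRight_tmul, coe_smul_left]; ring
  | add a b ha hb => rw [map_add, map_add, ha, hb]; ring

/-- The functional `y ↦ w ⋆ y` on the lattice, for `w` in `V ⊗ ℂ`. -/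
noncomputable def HermitianForm.functional (h : HermitianForm R V) (w : ℂ ⊗[R] V) :
    V →ₗ[R] ℂ where
  toFun y := conj (h.extendRight y w)
  map_add' x y := by rw [h.extendRight_add, map_add]
  map_smul' a x := by
    rw [h.extendRight_smul, map_mul, Complex.conj_conj]
    rfl

/-- The Hermitian form on the complex vector space `V ⊗ ℂ` that extends `h`, linear in the second
variable and conjugate-linear in the first. -/
noncomputable def HermitianForm.complexify (h : HermitianForm R V) (w : ℂ ⊗[R] V) :
    ℂ ⊗[R] V →ₗ[ℂ] ℂ :=
  TensorProduct.AlgebraTensorModule.lift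
    ((LinearMap.toSpanSingleton ℂ (V →ₗ[R] ℂ) (h.functional w)))

theorem HermitianForm.complexify_tmul (h : HermitianForm R V) (a b : ℂ) (x y : V) :
    h.complexify (a ⊗ₜ x) (b ⊗ₜ y) = conj a * b * (h x y : ℂ) := by
  simp [HermitianForm.complexify, HermitianForm.functional, extendRight_tmul, h.conj_symm]
  ring

/-- `h` has signature `(r, s)`: the complex vector space `V ⊗ ℂ` has a basis in which the extended
form is `diag(1, …, 1, -1, …, -1)` with `r` entries `1` and `s` entries `-1`. In particular `h` is
nondegenerate. -/
def HermitianForm.HasSignature (h : HermitianForm R V) (r s : ℕ) : Prop :=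
  ∃ b : Module.Basis (Fin r ⊕ Fin s) ℂ (ℂ ⊗[R] V),
    ∀ i j, h.complexify (b i) (b j) =
      Matrix.diagonal (Sum.elim (fun _ => (1 : ℂ)) (fun _ => (-1 : ℂ))) i j

/-- `x ⋆ x < 0` for every nonzero lattice vector (`x ⋆ x` is a real number). -/
def HermitianForm.IsNegDef (h : HermitianForm R V) : Prop :=
  ∀ x : V, x ≠ 0 → (h x x : ℂ).re < 0

/-- The Hermitian dual `V^∨ = {w ∈ V ⊗ ℂ : w ⋆ y ∈ R for all y ∈ V}`. -/
def HermitianForm.dual (h : HermitianForm R V) : Set (ℂ ⊗[R] V) :=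
  {w | ∀ y : V, h.complexify w (1 ⊗ₜ y) ∈ R}

/-- `α`-modularity: `V = α V^∨` inside `V ⊗ ℂ`. -/
def HermitianForm.IsModular (h : HermitianForm R V) (α : ℂ) : Prop :=
  Set.range (fun y : V => (1 : ℂ) ⊗ₜ[R] y) = (fun w => α • w) '' h.dual

/-- The group `U(V)` of `R`-linear automorphisms of `V` that preserve the form. -/
def HermitianForm.isometryGroup (h : HermitianForm R V) : Subgroup (V ≃ₗ[R] V) where
  carrier := {g | ∀ x y, h (g x) (g y) = h x y}
  mul_mem' {a b} ha hb x y := by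
    rw [LinearEquiv.mul_apply, LinearEquiv.mul_apply, ha, hb]
  one_mem' _ _ := rfl
  inv_mem' {a} ha x y := by
    have key : ∀ z, a (a⁻¹ z) = z := fun z => a.apply_symm_apply z
    rw [← ha (a⁻¹ x) (a⁻¹ y), key, key]

/-- A primitive vector: not a multiple of another vector by a non-unit. (Zero is not primitive,
because `0 = 0 • 0`.) -/
def IsPrimitive (e : V) : Prop := ∀ (a : R) (x : V), e = a • x → IsUnit a

/-- The primitive isotropic vectors, with the action of `U(V)` on them. -/
def HermitianForm.primitiveIsotropic (h : HermitianForm R V) :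
    SubMulAction h.isometryGroup V where
  carrier := {e | IsPrimitive (R := R) e ∧ h e e = 0}
  smul_mem' g e he := by
    refine ⟨fun a x hx => he.1 a (g.1⁻¹ x) ?_, ?_⟩
    · have h1 : g.1⁻¹ (g.1 e) = e := g.1.symm_apply_apply e
      have h2 : g.1 e = a • x := hx
      rw [← map_smul, ← h2, h1]
    · exact (g.2 e e).trans he.2

/-- The set of `U(V)`-orbits of primitive isotropic vectors. -/
abbrev HermitianForm.IsotropicOrbits (h : HermitianForm R V) : Type u :=
  MulAction.orbitRel.Quotient h.isometryGroup h.primitiveIsotropic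

/-- The orthogonal complement `e^⊥`. -/
def HermitianForm.perp (h : HermitianForm R V) (e : V) : Submodule R V := LinearMap.ker (h e)

/-- The multiples of `e`, as a submodule of `e^⊥` (when `e` is isotropic). -/
def HermitianForm.lineInPerp (h : HermitianForm R V) (e : V) : Submodule R (h.perp e) :=
  (Submodule.span R {e}).comap (h.perp e).subtype

/-- The quotient `e^⊥ / e`. -/
abbrev HermitianForm.PerpQuot (h : HermitianForm R V) (e : V) : Type u :=
  h.perp e ⧸ h.lineInPerp e

theorem HermitianForm.apply_line_right (h : HermitianForm R V) (e : V) (x z : h.perp e)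
    (hz : z ∈ h.lineInPerp e) : h x.1 z.1 = 0 := by
  obtain ⟨a, ha⟩ := Submodule.mem_span_singleton.1 hz
  have h1 : h x.1 e = 0 := by
    apply Subtype.ext
    rw [← h.conj_symm]
    have : h e x.1 = 0 := x.2
    rw [this]
    simp
  have h2 : a • e = z.1 := ha
  rw [← h2, map_smul, h1, smul_zero]

theorem HermitianForm.apply_line_left (h : HermitianForm R V) (e : V) (x z : h.perp e)
    (hz : z ∈ h.lineInPerp e) : h z.1 x.1 = 0 := by
  apply Subtype.ext
  rw [← h.conj_symm, h.apply_line_right e x z hz]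
  simp

/-- The Hermitian form on `e^⊥ / e` induced by `h`: `[x] ⋆ [y] = x ⋆ y`. -/
def HermitianForm.perpQuotForm (h : HermitianForm R V) (e : V) :
    HermitianForm R (h.PerpQuot e) where
  toFun := fun X => Quotient.liftOn' X
    (fun x => (h.lineInPerp e).liftQ ((h x.1) ∘ₗ (h.perp e).subtype)
      (fun z hz => h.apply_line_right e x z hz))
    (fun x x' hx => by
      have hx' : x - x' ∈ h.lineInPerp e := (Submodule.quotientRel_def _).1 hx
      apply Submodule.linearMap_qext
      ext1 y
      have h0 := h.apply_line_left e y (x - x') hx'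
      have h1 : x.1 = (x - x').1 + x'.1 := by simp
      change h x.1 y.1 = h x'.1 y.1
      rw [h1, h.map_add_left, h0, zero_add])
  conj_symm X Y := by
    induction X using Submodule.Quotient.induction_on with
    | _ x =>
      induction Y using Submodule.Quotient.induction_on with
      | _ y => exact h.conj_symm x.1 y.1

theorem HermitianForm.perpQuotForm_mk (h : HermitianForm R V) (e : V) (x y : h.perp e) :
    h.perpQuotForm e (Submodule.Quotient.mk x) (Submodule.Quotient.mk y) = h x.1 y.1 := rfl

/-- Two Hermitian modules are isometric. -/
def Isometric {W : Type v} [AddCommGroup W] [Module R W]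
    (h : HermitianForm R V) (h' : HermitianForm R W) : Prop :=
  ∃ f : V ≃ₗ[R] W, ∀ x y, h' (f x) (f y) = h x y

end Form

/-- A negative definite `α`-modular Hermitian lattice of rank `n` over `R`. -/
structure NegDefModularLattice (R : Subalgebra ℤ ℂ) (α : ℂ) (n : ℕ) where
  carrier : Type v
  [addCommGroup : AddCommGroup carrier]
  [module : Module R carrier]
  [free : Module.Free R carrier]
  [finite : Module.Finite R carrier]
  form : HermitianForm R carrier
  rank_eq : Module.finrank R carrier = n
  negDef : form.IsNegDef
  modular : form.IsModular α

attribute [instance] NegDefModularLattice.addCommGroup NegDefModularLattice.module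
  NegDefModularLattice.free NegDefModularLattice.finite

/-- Isometry of lattices, as an equivalence relation. -/
def isometrySetoid (R : Subalgebra ℤ ℂ) (α : ℂ) (n : ℕ) :
    Setoid (NegDefModularLattice.{v} R α n) where
  r L M := Isometric L.form M.form
  iseqv :=
    { refl := fun _ => ⟨LinearEquiv.refl _ _, fun _ _ => rfl⟩
      symm := fun ⟨f, hf⟩ => ⟨f.symm, fun x y => by
        rw [← hf, f.apply_symm_apply, f.apply_symm_apply]⟩
      trans := fun ⟨f, hf⟩ ⟨g, hg⟩ => ⟨f.trans g, fun x y => by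
        rw [LinearEquiv.trans_apply, LinearEquiv.trans_apply, hg, hf]⟩ }

/-- The set of isometry classes of negative definite `α`-modular lattices of rank `n` over `R`. -/
abbrev IsometryClasses (R : Subalgebra ℤ ℂ) (α : ℂ) (n : ℕ) : Type (v + 1) :=
  Quotient (isometrySetoid.{v} R α n)

end HermLat

/-! Write `α = 1 + ζ`. In an `α`-modular lattice `Λ` of signature `(1, s)`, a primitive isotropic
vector `e` has an isotropic partner `f` with `e ⋆ f = α`, so that `Λ` is the orthogonal sum of the
hyperbolic plane on `e`, `f` and a complement isometric to `e^⊥ / e`. An isometry between two such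
complements extends by the identity on the hyperbolic planes, whence the isometry class of
`e^⊥ / e` determines the orbit of `e`.

Every negative definite `α`-modular `L` of rank `s - 1` is some `e^⊥ / e`, because the orthogonal
sum of `L` with a hyperbolic plane is isometric to `Λ`: modular lattices of signature `(1, s)` are
determined by their rank. Indeed, such a lattice is a Lagrangian submodule modulo `α` of an odd
unimodular lattice of signature `(1, s)`. The latter is `⟨1⟩ ⊕ ⟨-1⟩ˢ`, since the ternary Hermitian
forms `⟨1, -a, -b⟩` with `a, b > 0` are isotropic by a descent, as in Legendre's theorem; and
transvections act transitively on its Lagrangian submodules. -/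

namespace HermLat

/-- A subring of `ℂ` that is stable under complex conjugation and whose real elements are integers,
such as an order in an imaginary quadratic field. -/
class IsConjStable (R : Subalgebra ℤ ℂ) : Prop where
  conj_mem : ∀ z ∈ R, conj z ∈ R
  exists_intCast_eq : ∀ z ∈ R, conj z = z → ∃ n : ℤ, (n : ℂ) = z

/-- A conjugation-stable subring of `ℂ` in which every complex number has an approximation at
squared distance at most `1 / 2`. The bound `1` would suffice for `R` to be norm-Euclidean; the
smaller one is what makes the descent in `represents_prime_of_lt` work for `a = -1`. -/
class IsNormEuclidean (R : Subalgebra ℤ ℂ) : Prop extends IsConjStable R where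
  approx : ∀ z : ℂ, ∃ r : R, Complex.normSq (z - r) ≤ 1 / 2

/-- Complex conjugation as an endomorphism of a conjugation-stable subring of `ℂ`. -/
def cj {R : Subalgebra ℤ ℂ} [IsConjStable R] : R →+* R :=
  ((starRingEnd ℂ).comp R.val.toRingHom).codRestrict R
    fun r => IsConjStable.conj_mem (r : ℂ) r.2

section Norm

variable {R : Subalgebra ℤ ℂ} [IsConjStable R]

@[simp] theorem coe_cj (r : R) : (cj r : ℂ) = conj (r : ℂ) := rfl

@[simp] theorem cj_cj (r : R) : cj (cj r) = r := Subtype.ext (Complex.conj_conj _)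

theorem cj_eq_zero {r : R} : cj r = 0 ↔ r = 0 :=
  map_eq_zero_iff cj (Function.LeftInverse.injective cj_cj)

theorem exists_intCast_eq_of_cj_eq {r : R} (hr : cj r = r) : ∃ n : ℤ, (n : R) = r := by
  obtain ⟨n, hn⟩ := IsConjStable.exists_intCast_eq (r : ℂ) r.2 (congrArg Subtype.val hr)
  exact ⟨n, Subtype.ext (by exact_mod_cast hn)⟩

theorem exists_intCast_eq_mul_cj (r : R) : ∃ n : ℤ, (n : R) = r * cj r :=
  exists_intCast_eq_of_cj_eq (by rw [map_mul, cj_cj, mul_comm])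

theorem exists_intCast_eq_add_cj (r : R) : ∃ n : ℤ, (n : R) = r + cj r :=
  exists_intCast_eq_of_cj_eq (by rw [map_add, cj_cj, add_comm])

/-- The norm `r * cj r`, as an integer. -/
noncomputable def nrm (r : R) : ℤ := (exists_intCast_eq_mul_cj r).choose

theorem coe_nrm (r : R) : (nrm r : R) = r * cj r := (exists_intCast_eq_mul_cj r).choose_spec

theorem nrm_eq_iff {r : R} {n : ℤ} : nrm r = n ↔ r * cj r = n := by
  rw [← coe_nrm, Int.cast_inj]

theorem cast_nrm (r : R) : (nrm r : ℝ) = Complex.normSq (r : ℂ) := by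
  have hcoe : ((nrm r : R) : ℂ) = (r : ℂ) * conj (r : ℂ) := congrArg Subtype.val (coe_nrm r)
  rw [Complex.mul_conj] at hcoe
  exact Complex.ofReal_injective ((Complex.ofReal_intCast _).trans hcoe)

theorem nrm_nonneg (r : R) : 0 ≤ nrm r := by
  exact_mod_cast (cast_nrm r).symm ▸ Complex.normSq_nonneg (r : ℂ)

theorem nrm_eq_zero {r : R} : nrm r = 0 ↔ r = 0 := by
  rw [← Int.cast_eq_zero (α := ℝ), cast_nrm, Complex.normSq_eq_zero, ZeroMemClass.coe_eq_zero]

theorem nrm_pos {r : R} : 0 < nrm r ↔ r ≠ 0 := by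
  rw [(nrm_nonneg r).lt_iff_ne', ne_eq, nrm_eq_zero]

@[simp] theorem nrm_zero : nrm (0 : R) = 0 := nrm_eq_zero.2 rfl

@[simp] theorem nrm_one : nrm (1 : R) = 1 := by
  rw [nrm_eq_iff, map_one, one_mul, Int.cast_one]

theorem nrm_mul (a b : R) : nrm (a * b) = nrm a * nrm b := by
  rw [nrm_eq_iff, map_mul, Int.cast_mul, coe_nrm, coe_nrm]
  ring

@[simp] theorem nrm_intCast (n : ℤ) : nrm (n : R) = n ^ 2 := by
  rw [nrm_eq_iff, map_intCast, Int.cast_pow, sq]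

@[simp] theorem nrm_natCast (n : ℕ) : nrm (n : R) = n ^ 2 := by
  simpa only [Int.cast_natCast] using nrm_intCast (R := R) n

theorem isUnit_iff_nrm_eq_one {r : R} : IsUnit r ↔ nrm r = 1 := by
  refine ⟨fun hr => ?_, fun hr => IsUnit.of_mul_eq_one (cj r) (by rw [← coe_nrm, hr, Int.cast_one])⟩
  obtain ⟨s, hs⟩ := hr.exists_right_inv
  refine Int.eq_one_of_mul_eq_one_right (nrm_nonneg r) (b := nrm s) ?_
  rw [← nrm_mul, hs, nrm_one]

theorem dvd_of_intCast_dvd_intCast {m n : ℤ} (h : (m : R) ∣ n) : m ∣ n := by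
  obtain ⟨c, hc⟩ := h
  have hsq : m ^ 2 ∣ n ^ 2 :=
    ⟨nrm c, by rw [← nrm_intCast (R := R) n, hc, nrm_mul, nrm_intCast]⟩
  exact (Int.pow_dvd_pow_iff two_ne_zero).1 hsq

end Norm

section Euclidean

variable {R : Subalgebra ℤ ℂ} [IsNormEuclidean R]

theorem exists_two_mul_nrm_sub_le (a : R) {b : R} (hb : b ≠ 0) :
    ∃ q : R, 2 * nrm (a - b * q) ≤ nrm b := by
  obtain ⟨q, hq⟩ := IsNormEuclidean.approx (R := R) ((a : ℂ) / b)
  have hb' : (b : ℂ) ≠ 0 := fun h => hb (Subtype.ext h)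
  have hfactor : ((a - b * q : R) : ℂ) = b * ((a : ℂ) / b - q) := by
    push_cast
    field_simp
  have hreal : (2 * nrm (a - b * q) : ℝ) ≤ nrm b := by
    rw [cast_nrm, cast_nrm, hfactor, Complex.normSq_mul]
    nlinarith [Complex.normSq_nonneg (b : ℂ)]
  exact ⟨q, by exact_mod_cast hreal⟩

instance : IsPrincipalIdealRing R where
  principal I := by
    by_cases hI : I = ⊥
    · exact hI ▸ bot_isPrincipal
    obtain ⟨x, hxI, hx⟩ := Submodule.exists_mem_ne_zero_of_ne_bot hI
    obtain ⟨b, ⟨hbI, hb⟩, hmin⟩ := exists_minimalFor_of_wellFoundedLT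
      (fun r : R => r ∈ I ∧ r ≠ 0) (fun r => (nrm r).toNat) ⟨x, hxI, hx⟩
    refine ⟨b, le_antisymm (fun a ha => ?_) ((Submodule.span_singleton_le_iff_mem _ _).2 hbI)⟩
    obtain ⟨q, hq⟩ := exists_two_mul_nrm_sub_le a hb
    have hremainder : a - b * q = 0 := by
      by_contra hne
      have hle := hmin ⟨I.sub_mem ha (I.mul_mem_right _ hbI), hne⟩
      have hbpos := nrm_pos.2 hb
      have hpos := nrm_pos.2 hne
      simp only at hle
      omega
    exact Submodule.mem_span_singleton.2 ⟨q, by rw [smul_eq_mul]; linear_combination -hremainder⟩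

end Euclidean

/-! ### Norms modulo primes and the binary forms `⟨1, -a⟩` -/

section NormResidue

variable {R : Subalgebra ℤ ℂ}

theorem exists_nrm_eq_of_not_prime [IsConjStable R] [IsPrincipalIdealRing R] {p : ℕ}
    (hp : p.Prime) (hR : ¬ Prime (p : R)) : ∃ r : R, nrm r = p := by
  have hp_unit : ¬ IsUnit (p : R) := by
    rw [isUnit_iff_nrm_eq_one, nrm_natCast]
    exact_mod_cast (Nat.one_lt_pow two_ne_zero hp.one_lt).ne'
  obtain ⟨a, b, hab, ha, hb⟩ : ∃ a b : R, (p : R) = a * b ∧ ¬ IsUnit a ∧ ¬ IsUnit b := by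
    by_contra! hirr
    refine hR (Irreducible.prime ⟨hp_unit, fun a b hab => ?_⟩)
    exact or_iff_not_imp_left.2 (hirr a b hab)
  have hnrm : nrm a * nrm b = p ^ 2 := by rw [← nrm_mul, ← hab, nrm_natCast]
  rw [isUnit_iff_nrm_eq_one] at ha hb
  refine ⟨a, ?_⟩
  lift nrm a to ℕ using nrm_nonneg a with m
  lift nrm b to ℕ using nrm_nonneg b with n
  norm_cast at hnrm ha hb
  exact congrArg Nat.cast ((hp.mul_eq_prime_sq_iff ha hb).1 hnrm).1

theorem exists_cj_ne [IsNormEuclidean R] : ∃ g : R, cj g ≠ g := by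
  obtain ⟨g, hg⟩ := IsNormEuclidean.approx (R := R) (2 * Complex.I)
  refine ⟨g, fun hreal => ?_⟩
  have him : (g : ℂ).im = 0 := Complex.conj_eq_iff_im.1 (congrArg Subtype.val hreal)
  rw [Complex.normSq_apply] at hg
  norm_num [him] at hg
  nlinarith [mul_self_nonneg (g : ℂ).re]

/-- If an odd `p` divides `g - cj g`, then `u = (g - cj g) / p` has `u - cj u = 2 * u`, which is
smaller than `g - cj g`. -/
theorem exists_not_dvd_sub_cj [IsNormEuclidean R] :
    ∃ g : R, ∀ p : ℕ, 2 < p → ¬ (p : R) ∣ g - cj g := by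
  obtain ⟨g₀, hg₀⟩ := exists_cj_ne (R := R)
  obtain ⟨g, hg, hmin⟩ := exists_minimalFor_of_wellFoundedLT
    (fun g : R => cj g ≠ g) (fun g => (nrm (g - cj g)).toNat) ⟨g₀, hg₀⟩
  refine ⟨g, fun p hp ⟨u, hu⟩ => ?_⟩
  have hp0 : (p : R) ≠ 0 := Nat.cast_ne_zero.2 (by omega)
  have hu_anti : cj u = -u := mul_left_cancel₀ hp0 <| by
    rw [mul_neg, ← hu, ← map_natCast cj p, ← map_mul, ← hu, map_sub, cj_cj, neg_sub]
  have hu0 : u ≠ 0 := by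
    rintro rfl
    exact hg (sub_eq_zero.1 (hu.trans (mul_zero _))).symm
  have hu_sub : u - cj u = (2 : ℤ) * u := by
    rw [hu_anti]
    push_cast
    ring
  have hu_ne : cj u ≠ u := by rwa [hu_anti, ne_eq, neg_eq_self]
  have hle := hmin (j := u) hu_ne
  simp only [hu, hu_sub, nrm_mul, nrm_natCast, nrm_intCast] at hle
  have hu_pos := nrm_pos.2 hu0
  have hp_sq : (9 : ℤ) ≤ p ^ 2 := by nlinarith
  have : 9 * nrm u ≤ p ^ 2 * nrm u := mul_le_mul_of_nonneg_right hp_sq hu_pos.le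
  omega

theorem exists_dvd_sq_add_mul_sq_sub {p : ℕ} (hp : p.Prime) (hp2 : p ≠ 2) {d : ℤ}
    (hd : ¬ (p : ℤ) ∣ d) (n : ℤ) : ∃ x y : ℤ, (p : ℤ) ∣ x ^ 2 + d * y ^ 2 - n := by
  have := Fact.mk hp
  have hd0 : (d : ZMod p) ≠ 0 := by rwa [ne_eq, ZMod.intCast_zmod_eq_zero_iff_dvd]
  open Polynomial in
  obtain ⟨x, y, hxy⟩ := FiniteField.exists_root_sum_quadratic
    (degree_X_pow_sub_C two_pos (n : ZMod p)) (degree_C_mul_X_pow 2 hd0)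
    (by rw [ZMod.card]; exact hp.eq_two_or_odd.resolve_left hp2)
  obtain ⟨x, rfl⟩ := ZMod.intCast_surjective x
  obtain ⟨y, rfl⟩ := ZMod.intCast_surjective y
  refine ⟨x, y, (ZMod.intCast_zmod_eq_zero_iff_dvd _ _).1 ?_⟩
  simp only [Polynomial.eval_sub, Polynomial.eval_pow, Polynomial.eval_X, Polynomial.eval_C,
    Polynomial.eval_mul] at hxy
  push_cast
  linear_combination hxy

/-- For odd `p`, the norm form takes the values `x ^ 2 + d * y ^ 2` with
`d = -(g - cj g) ^ 2`, which is prime to `p` for a suitable `g`. -/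
theorem exists_dvd_nrm_sub_of_prime [IsNormEuclidean R] {p : ℕ} (hR : Prime (p : R))
    (hp : p.Prime) (n : ℤ) : ∃ t : R, (p : ℤ) ∣ nrm t - n := by
  rcases eq_or_ne p 2 with rfl | hp2
  · refine ⟨(n : R), ?_⟩
    rw [nrm_intCast, sq, ← mul_sub_one, Nat.cast_ofNat]
    exact (Int.even_mul_pred_self n).two_dvd
  obtain ⟨g, hg⟩ := exists_not_dvd_sub_cj (R := R)
  obtain ⟨T, hT⟩ := exists_intCast_eq_add_cj g
  have hd : ¬ (p : ℤ) ∣ 4 * nrm g - T ^ 2 := fun ⟨c, hc⟩ => by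
    have hsq : (g - cj g) ^ 2 = -(p * (c : R)) := by
      rw [← Int.cast_natCast, ← Int.cast_mul, ← hc]
      push_cast
      rw [hT, coe_nrm]
      ring
    exact hg p (lt_of_le_of_ne hp.two_le hp2.symm)
      (hR.dvd_of_dvd_pow (hsq ▸ (dvd_mul_right _ _).neg_right))
  obtain ⟨x, y, hxy⟩ := exists_dvd_sq_add_mul_sq_sub hp hp2 hd n
  refine ⟨x - T * y + 2 * y * g, ?_⟩
  convert hxy using 2
  rw [nrm_eq_iff]
  simp only [map_add, map_sub, map_mul, map_intCast, map_ofNat]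
  push_cast
  rw [coe_nrm]
  have hcj : cj g = T - g := by rw [hT]; ring
  rw [hcj]
  ring

end NormResidue

section Represents

variable {R : Subalgebra ℤ ℂ}

/-- The binary Hermitian form `⟨1, -a⟩` over the fraction field of `R` represents `m`. -/
def Represents (R : Subalgebra ℤ ℂ) [IsConjStable R] (a m : ℤ) : Prop :=
  ∃ x y z : R, z ≠ 0 ∧ nrm x - a * nrm y = m * nrm z

section ConjStable

variable [IsConjStable R] {a b m n : ℤ}

theorem represents_nrm_sub_mul (a : ℤ) (t s : R) : Represents R a (nrm t - a * nrm s) :=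
  ⟨t, s, 1, one_ne_zero, by rw [nrm_one, mul_one]⟩

theorem represents_nrm (a : ℤ) (t : R) : Represents R a (nrm t) := by
  simpa only [nrm_zero, mul_zero, sub_zero] using represents_nrm_sub_mul a t 0

theorem represents_one (a : ℤ) : Represents R a 1 := by
  simpa only [nrm_one] using represents_nrm a (1 : R)

theorem Represents.mul (hm : Represents R a m) (hn : Represents R a n) :
    Represents R a (m * n) := by
  obtain ⟨x, y, z, hz, hm⟩ := hm
  obtain ⟨u, v, w, hw, hn⟩ := hn
  refine ⟨x * u + (a : R) * (y * cj v), x * v + y * cj u, z * w, mul_ne_zero hz hw, ?_⟩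
  have norm_form_mul : nrm (x * u + (a : R) * (y * cj v)) - a * nrm (x * v + y * cj u) =
      (nrm x - a * nrm y) * (nrm u - a * nrm v) := by
    apply Int.cast_injective (α := R)
    push_cast
    simp only [coe_nrm, map_mul, map_add, cj_cj, map_intCast]
    ring
  rw [norm_form_mul, hm, hn, nrm_mul]
  ring

theorem Represents.of_mul_left (hmn : Represents R a (m * n)) (hm : Represents R a m)
    (hm0 : m ≠ 0) : Represents R a n := by
  obtain ⟨x, y, z, hz, h⟩ := hmn.mul hm
  refine ⟨x, y, m * z, mul_ne_zero (Int.cast_ne_zero.2 hm0) hz, ?_⟩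
  rw [h, nrm_mul, nrm_intCast]
  ring

/-- If `a` is a norm, then `⟨1, -a⟩` is isotropic, hence universal. -/
theorem represents_of_nrm_eq_mul_nrm (ha : a ≠ 0) {x z : R} (hz : z ≠ 0)
    (h : nrm x = a * nrm z) (m : ℤ) : Represents R a m := by
  have hx : x ≠ 0 := by
    rw [ne_eq, ← nrm_eq_zero, h]
    exact mul_ne_zero ha (nrm_pos.2 hz).ne'
  refine ⟨(m + 1 : ℤ) * x, (m - 1 : ℤ) * z, (2 : ℤ) * x,
    mul_ne_zero (Int.cast_ne_zero.2 two_ne_zero) hx, ?_⟩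
  simp only [nrm_mul, nrm_intCast]
  linear_combination (m - 1) ^ 2 * h

theorem Represents.symm (hb : b ≠ 0) (h : Represents R a b) : Represents R b a := by
  obtain ⟨x, y, z, hz, h⟩ := h
  by_cases hy : y = 0
  · have hnorm : nrm x = b * nrm z := by rw [← h, hy, nrm_zero, mul_zero, sub_zero]
    exact represents_of_nrm_eq_mul_nrm hb hz hnorm a
  · exact ⟨x, z, y, hy, by linear_combination h⟩

theorem represents_of_forall_prime {n : ℕ} (hn : n ≠ 0)
    (H : ∀ p : ℕ, p.Prime → p ∣ n → Represents R a p) : Represents R a n := by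
  induction n using induction_on_primes with
  | zero => exact absurd rfl hn
  | one => exact_mod_cast represents_one a
  | prime_mul p n hp ih =>
    rw [Nat.cast_mul]
    exact (H p hp (dvd_mul_right p n)).mul
      (ih (right_ne_zero_of_mul hn) fun q hq hqn => H q hq (hqn.mul_left p))

theorem intCast_dvd_nrm_sub_nrm {s t : R} (h : (m : R) ∣ s - t) : m ∣ nrm s - nrm t := by
  have hcj : (m : R) ∣ cj (s - t) := map_intCast (cj (R := R)) m ▸ map_dvd cj h
  refine dvd_of_intCast_dvd_intCast (R := R) ?_
  have hsplit : ((nrm s - nrm t : ℤ) : R) = (s - t) * cj s + t * cj (s - t) := by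
    push_cast
    rw [coe_nrm, coe_nrm, map_sub]
    ring
  exact hsplit ▸ dvd_add (h.mul_right _) (hcj.mul_left t)

end ConjStable

variable [IsNormEuclidean R]

theorem exists_nrm_eq_add_mul {p : ℕ} (hp : p.Prime) (hR : Prime (p : R)) (a : ℤ) :
    ∃ (t : R) (r : ℤ), nrm t = a + p * r ∧ 2 * nrm t ≤ p ^ 2 := by
  obtain ⟨t, ht⟩ := exists_dvd_nrm_sub_of_prime hR hp a
  obtain ⟨q, hq⟩ := exists_two_mul_nrm_sub_le t hR.ne_zero
  have hcong : (p : ℤ) ∣ nrm (t - (p : R) * q) - nrm t :=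
    intCast_dvd_nrm_sub_nrm ⟨-q, by push_cast; ring⟩
  obtain ⟨r, hr⟩ := dvd_add hcong ht
  exact ⟨t - (p : R) * q, r, by linear_combination hr, nrm_natCast (R := R) p ▸ hq⟩

theorem represents_prime_of_lt {a : ℤ} {p : ℕ} (hp : p.Prime) (ha : a ≠ 0) (hap : |a| < p)
    (ih : ∀ r : ℕ, r ≠ 0 → r < p → Represents R a r) : Represents R a p := by
  by_cases hR : Prime (p : R)
  swap
  · obtain ⟨t, ht⟩ := exists_nrm_eq_of_not_prime hp hR
    exact ht ▸ represents_nrm a t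
  obtain ⟨t, r, ht, hbound⟩ := exists_nrm_eq_add_mul hp hR a
  obtain ⟨hap_neg, hap_pos⟩ := abs_lt.1 hap
  have hp2 : (2 : ℤ) ≤ p := by exact_mod_cast hp.two_le
  have hr_nonneg : 0 ≤ r := by
    by_contra! hr
    nlinarith [nrm_nonneg t]
  have hr_lt : r < p := by
    by_contra! hr
    nlinarith
  lift r to ℕ using hr_nonneg
  rcases eq_or_ne r 0 with rfl | hr
  · rw [Nat.cast_zero, mul_zero, add_zero] at ht
    exact represents_of_nrm_eq_mul_nrm ha one_ne_zero (by rw [ht, nrm_one, mul_one]) p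
  · have hmul : Represents R a (r * p) := by
      have := represents_nrm_sub_mul a t (1 : R)
      rwa [ht, nrm_one, mul_one, add_sub_cancel_left, mul_comm] at this
    exact hmul.of_mul_left (ih r hr (by exact_mod_cast hr_lt)) (Nat.cast_ne_zero.2 hr)

theorem represents_neg_one {n : ℕ} (hn : n ≠ 0) : Represents R (-1) n := by
  induction n using Nat.strong_induction_on with
  | _ n ih =>
    refine represents_of_forall_prime hn fun p hp hpn => ?_
    refine represents_prime_of_lt hp (by norm_num) ?_ fun r hr hrp => ?_
    · rw [abs_neg, abs_one]
      exact_mod_cast hp.one_lt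
    · exact ih r (hrp.trans_le (Nat.le_of_dvd (Nat.pos_of_ne_zero hn) hpn)) hr

theorem represents_self {n : ℕ} (hn : n ≠ 0) : Represents R n n := by
  have hn' : (n : ℤ) ≠ 0 := Nat.cast_ne_zero.2 hn
  have hneg : Represents R (n : ℤ) (-1 * n) := by
    simpa using represents_nrm_sub_mul (n : ℤ) (0 : R) 1
  exact hneg.of_mul_left ((represents_neg_one hn).symm hn') (by norm_num)

theorem represents_prime_of_prime_lt {p q : ℕ} (hp : p.Prime) (hq : q.Prime) (hpq : p < q) :
    Represents R p q := by
  induction q using Nat.strong_induction_on generalizing p with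
  | _ q ih =>
    refine represents_prime_of_lt hq (Nat.cast_ne_zero.2 hp.ne_zero) (by simpa using hpq)
      fun r hr hrq => represents_of_forall_prime hr fun l hl hlr => ?_
    have hlq : l < q := (Nat.le_of_dvd (Nat.pos_of_ne_zero hr) hlr).trans_lt hrq
    rcases lt_trichotomy p l with hpl | rfl | hlp
    · exact ih l hlq hp hl hpl
    · exact represents_self hp.ne_zero
    · exact (ih p hpq hl hp hlp).symm (Nat.cast_ne_zero.2 hp.ne_zero)

theorem represents_prime_prime {p q : ℕ} (hp : p.Prime) (hq : q.Prime) : Represents R p q := by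
  rcases lt_trichotomy p q with hpq | rfl | hqp
  · exact represents_prime_of_prime_lt hp hq hpq
  · exact represents_self hp.ne_zero
  · exact (represents_prime_of_prime_lt hq hp hqp).symm (Nat.cast_ne_zero.2 hp.ne_zero)

/-- Equivalently, the ternary Hermitian form `⟨1, -a, -b⟩` is isotropic. -/
theorem represents_of_pos {a b : ℤ} (ha : 0 < a) (hb : 0 < b) : Represents R a b := by
  lift a to ℕ using ha.le
  lift b to ℕ using hb.le
  refine represents_of_forall_prime (by omega) fun q hq _ => ?_
  refine Represents.symm (Nat.cast_ne_zero.2 (by omega)) ?_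
  exact represents_of_forall_prime (by omega) fun p hp _ => represents_prime_prime hq hp

end Represents

/-! ### Hermitian lattices -/

section Functional

variable {R : Type*} [CommRing R] [IsDomain R] {V : Type*} [AddCommGroup V] [Module R V]

theorem exists_eq_smul_of_forall_dvd {φ : V →ₗ[R] R} {a : R} (ha : a ≠ 0) (H : ∀ x, a ∣ φ x) :
    ∃ ψ : V →ₗ[R] R, φ = a • ψ := by
  let divBy := LinearEquiv.ofInjective (LinearMap.mulLeft R a) (mul_right_injective₀ ha)
  have hmem : ∀ x, φ x ∈ LinearMap.range (LinearMap.mulLeft R a) := fun x => by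
    obtain ⟨c, hc⟩ := H x
    exact ⟨c, hc.symm⟩
  refine ⟨divBy.symm ∘ₗ φ.codRestrict _ hmem, LinearMap.ext fun x => ?_⟩
  exact (congrArg Subtype.val (divBy.apply_symm_apply (φ.codRestrict _ hmem x))).symm

theorem exists_eq_smul_of_ne_zero [IsPrincipalIdealRing R] {φ : V →ₗ[R] R} (hφ : φ ≠ 0) :
    ∃ (g : R) (ψ : V →ₗ[R] R) (x : V), φ = g • ψ ∧ ψ x = 1 := by
  obtain ⟨g, hg⟩ := (IsPrincipalIdealRing.principal (LinearMap.range φ)).principal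
  have hg0 : g ≠ 0 := by
    rintro rfl
    exact hφ (LinearMap.range_eq_bot.1 (hg.trans (by simp)))
  have hdvd : ∀ x, g ∣ φ x := fun x =>
    Ideal.mem_span_singleton.1 (hg.le (LinearMap.mem_range_self φ x))
  obtain ⟨ψ, rfl⟩ := exists_eq_smul_of_forall_dvd hg0 hdvd
  obtain ⟨x, hx⟩ : g ∈ LinearMap.range (g • ψ) := hg ▸ Submodule.mem_span_singleton_self g
  exact ⟨g, ψ, x, rfl, mul_left_cancel₀ hg0 (hx.trans (mul_one g).symm)⟩

end Functional

namespace HermitianForm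

section Basic

variable {R : Subalgebra ℤ ℂ} {V : Type u} [AddCommGroup V] [Module R V]

/-- The restriction of a form to a submodule. -/
def restrict (h : HermitianForm R V) (N : Submodule R V) : HermitianForm R N where
  toFun x := (h x.1) ∘ₗ N.subtype
  conj_symm x y := h.conj_symm x.1 y.1

@[simp] theorem restrict_apply (h : HermitianForm R V) (N : Submodule R V) (x y : N) :
    h.restrict N x y = h x y := rfl

/-- The form is nondegenerate: only `0` is orthogonal to the whole module. -/
def Nondegenerate (h : HermitianForm R V) : Prop := ∀ x, h x = 0 → x = 0

/-- The form takes values in `αR` and, after division by `α`, induces all functionals. For a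
nondegenerate lattice and a modulus `α` this is `α`-modularity, see `IsModular.perfect` and
`Perfect.isModular`; `Perfect 1` is unimodularity. -/
def Perfect (h : HermitianForm R V) (α : R) : Prop :=
  (∀ x y, α ∣ h x y) ∧ ∀ φ : V →ₗ[R] R, ∃ y, h y = α • φ

variable {h : HermitianForm R V}

theorem Perfect.restrict_of_projection {α : R} (P : h.Perfect α) {N : Submodule R V}
    {π : V →ₗ[R] N} (hπ : ∀ x : N, π x = x) (horth : ∀ (v : V) (x : N), h (π v) x = h v x) :
    (h.restrict N).Perfect α := by
  refine ⟨fun x y => P.1 x y, fun φ => ?_⟩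
  obtain ⟨y, hy⟩ := P.2 (φ ∘ₗ π)
  refine ⟨π y, LinearMap.ext fun x => ?_⟩
  rw [restrict_apply, horth, hy, LinearMap.smul_apply, LinearMap.comp_apply, hπ,
    LinearMap.smul_apply]

end Basic

section ConjStable

variable {R : Subalgebra ℤ ℂ} [IsConjStable R] {V : Type u} [AddCommGroup V] [Module R V]
  (h : HermitianForm R V)

theorem cj_apply (x y : V) : cj (h x y) = h y x := Subtype.ext (h.conj_symm y x)

theorem apply_eq_zero_comm {x y : V} : h x y = 0 ↔ h y x = 0 := by
  rw [← h.cj_apply y x, cj_eq_zero]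

theorem smul_left (a : R) (x y : V) : h (a • x) y = cj a * h x y := by
  rw [← h.cj_apply y, map_smul, smul_eq_mul, map_mul, h.cj_apply]

theorem zero_left (y : V) : h 0 y = 0 := by
  rw [← h.cj_apply y, map_zero, map_zero]

theorem sub_left (x y z : V) : h (x - y) z = h x z - h y z := by
  rw [← h.cj_apply z, map_sub, map_sub, h.cj_apply, h.cj_apply]

theorem sum_left {ι : Type*} (s : Finset ι) (w : ι → V) (z : V) :
    h (∑ i ∈ s, w i) z = ∑ i ∈ s, h (w i) z := by
  simp only [← h.cj_apply z, map_sum]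

/-- The integer `x ⋆ x`. -/
noncomputable def sq (x : V) : ℤ := (exists_intCast_eq_of_cj_eq (h.cj_apply x x)).choose

theorem coe_sq (x : V) : (h.sq x : R) = h x x :=
  (exists_intCast_eq_of_cj_eq (h.cj_apply x x)).choose_spec

variable {h} in
theorem sq_eq_iff {x : V} {n : ℤ} : h.sq x = n ↔ h x x = n := by
  rw [← h.coe_sq, Int.cast_inj]

theorem cast_sq (x : V) : (h.sq x : ℝ) = (h x x : ℂ).re := by
  simp [← h.coe_sq x]

theorem sq_zero : h.sq 0 = 0 := sq_eq_iff.2 (by rw [map_zero, Int.cast_zero])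

theorem sq_smul (a : R) (x : V) : h.sq (a • x) = nrm a * h.sq x := by
  rw [sq_eq_iff, map_smul, smul_left, smul_eq_mul]
  push_cast
  rw [coe_nrm, coe_sq]
  ring

theorem sq_smul_add_smul (a b : R) {x y : V} (hxy : h x y = 0) :
    h.sq (a • x + b • y) = nrm a * h.sq x + nrm b * h.sq y := by
  rw [sq_eq_iff]
  push_cast
  simp only [coe_nrm, coe_sq, map_add_left, smul_left, map_add, map_smul, smul_eq_mul, hxy,
    h.apply_eq_zero_comm.1 hxy]
  ring

@[simp] theorem restrict_sq (N : Submodule R V) (x : N) : (h.restrict N).sq x = h.sq x :=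
  sq_eq_iff.2 (h.coe_sq (x : V)).symm

theorem isNegDef_iff : h.IsNegDef ↔ ∀ x, x ≠ 0 → h.sq x < 0 := by
  refine forall_congr' fun x => imp_congr_right fun _ => ?_
  rw [← h.cast_sq, Int.cast_lt_zero]

/-- There is a positive vector with negative definite orthogonal complement: the lattice has
signature `(1, s)`, see `HasSignature.lorentzian`. -/
def Lorentzian : Prop :=
  ∃ v, 0 < h.sq v ∧ ∀ y, h v y = 0 → y ≠ 0 → h.sq y < 0

variable {h}

theorem Nondegenerate.ext_left (N : h.Nondegenerate) {x y : V} (hxy : h x = h y) : x = y := by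
  refine sub_eq_zero.1 (N _ (LinearMap.ext fun z => ?_))
  rw [h.sub_left, hxy, sub_self, LinearMap.zero_apply]

theorem Lorentzian.nondegenerate (H : h.Lorentzian) : h.Nondegenerate := by
  obtain ⟨v, -, hneg⟩ := H
  intro x hx
  by_contra hx0
  have hvx : h v x = 0 := by rw [h.apply_eq_zero_comm, hx, LinearMap.zero_apply]
  have hsq : h.sq x = 0 := by rw [sq_eq_iff, hx, LinearMap.zero_apply, Int.cast_zero]
  exact (hneg x hvx hx0).ne hsq

theorem Lorentzian.sq_neg (H : h.Lorentzian) {x y : V} (hx : 0 < h.sq x) (hxy : h x y = 0)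
    (hy : y ≠ 0) : h.sq y < 0 := by
  obtain ⟨v, -, hneg⟩ := H
  by_contra! hy_nonneg
  have hsq := h.sq_smul_add_smul (h v y) (-h v x) hxy
  have hcomb : h v y • x + (-h v x) • y = 0 := by
    by_contra hne
    have := hneg _ (by simp only [map_add, map_smul, smul_eq_mul]; ring) hne
    have := mul_nonneg (nrm_nonneg (h v y)) hx.le
    have := mul_nonneg (nrm_nonneg (-h v x)) hy_nonneg
    omega
  have hvy : h v y = 0 := by
    have hprod : h v y * h x x = 0 := by
      simpa only [map_add, map_smul, smul_eq_mul, hxy, mul_zero, add_zero, map_zero]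
        using congrArg (h x) hcomb
    refine (mul_eq_zero.1 hprod).resolve_right ?_
    rw [← h.coe_sq, Int.cast_eq_zero]
    exact hx.ne'
  exact (hneg y hvy hy).not_ge hy_nonneg

theorem Lorentzian.restrict (H : h.Lorentzian) {N : Submodule R V} {x : V} (hx : x ∈ N)
    (hpos : 0 < h.sq x) : (h.restrict N).Lorentzian :=
  ⟨⟨x, hx⟩, by rwa [restrict_sq], fun y hxy hy => by
    rw [restrict_sq]
    exact H.sq_neg hpos hxy (mt (fun hy0 => Subtype.ext hy0) hy)⟩

theorem Perfect.exists_smul_eq_and_apply_eq [IsPrincipalIdealRing R] {α : R} (hα : α ≠ 0)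
    (P : h.Perfect α) (N : h.Nondegenerate) {e : V} (he : e ≠ 0) :
    ∃ (g : R) (e' f : V), e = g • e' ∧ h e' f = α := by
  obtain ⟨ψ, hψ⟩ := exists_eq_smul_of_forall_dvd hα (P.1 e)
  have hψ0 : ψ ≠ 0 := by
    rintro rfl
    exact he (N e (by rw [hψ, smul_zero]))
  obtain ⟨g, χ, f, rfl, hf⟩ := exists_eq_smul_of_ne_zero hψ0
  obtain ⟨e', he'⟩ := P.2 χ
  refine ⟨cj g, e', f, N.ext_left (LinearMap.ext fun x => ?_), ?_⟩
  · rw [smul_left, cj_cj, hψ, he', smul_comm, LinearMap.smul_apply, smul_eq_mul]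
  · rw [he', LinearMap.smul_apply, hf, smul_eq_mul, mul_one]

end ConjStable

section Gram

variable {R : Subalgebra ℤ ℂ} {V : Type u} [AddCommGroup V] [Module R V] {ι : Type*}
  {h : HermitianForm R V}

/-- The Gram matrix of a form with respect to a basis. -/
noncomputable def gram (h : HermitianForm R V) (b : Module.Basis ι R V) : Matrix ι ι R :=
  Matrix.of fun i j => h (b i) (b j)

theorem gram_apply (b : Module.Basis ι R V) (i j : ι) : h.gram b i j = h (b i) (b j) := rfl

variable [IsConjStable R] [Fintype ι]

theorem sum_smul_apply_basis (b : Module.Basis ι R V) (c : ι → R) (j : ι) :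
    h (∑ i, cj (c i) • b i) (b j) = Matrix.vecMul c (h.gram b) j := by
  simp only [sum_left, smul_left, cj_cj, Matrix.vecMul, dotProduct, gram_apply]

variable [DecidableEq ι]

theorem Nondegenerate.det_gram_ne_zero (N : h.Nondegenerate) (b : Module.Basis ι R V) :
    (h.gram b).det ≠ 0 := by
  intro hdet
  obtain ⟨c, hc, hcG⟩ := Matrix.exists_vecMul_eq_zero_iff.2 hdet
  have hzero : ∑ i, cj (c i) • b i = 0 :=
    N _ (b.ext fun j => by rw [sum_smul_apply_basis, hcG, LinearMap.zero_apply, Pi.zero_apply])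
  exact hc (funext fun i =>
    cj_eq_zero.1 (Fintype.linearIndependent_iff.1 b.linearIndependent _ hzero i))

theorem exists_eq_det_gram_smul (b : Module.Basis ι R V) (φ : V →ₗ[R] R) :
    ∃ y, h y = (h.gram b).det • φ := by
  refine ⟨∑ i, cj (Matrix.vecMul (φ ∘ b) (h.gram b).adjugate i) • b i, b.ext fun j => ?_⟩
  rw [sum_smul_apply_basis, Matrix.vecMul_vecMul, Matrix.adjugate_mul, Matrix.vecMul_smul,
    Matrix.vecMul_one]
  rfl

theorem Perfect.isUnit_det_gram (P : h.Perfect 1) (b : Module.Basis ι R V) :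
    IsUnit (h.gram b).det := by
  choose y hy using fun i => P.2 (b.coord i)
  refine Matrix.isUnit_det_of_left_inverse
    (B := Matrix.of fun i k => cj (b.repr (y i) k)) (Matrix.ext fun i j => ?_)
  have hrow := sum_smul_apply_basis (h := h) b (fun k => cj (b.repr (y i) k)) j
  simp only [cj_cj, b.sum_repr, hy, one_smul, Module.Basis.coord_apply, b.repr_self] at hrow
  rw [Matrix.one_apply, Matrix.mul_apply_eq_vecMul]
  refine hrow.symm.trans ?_
  rw [Finsupp.single_apply]
  exact if_congr eq_comm rfl rfl

end Gram

end HermitianForm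

theorem exists_ne_zero_and_apply_eq_zero {R V W : Type*} [CommRing R] [IsDomain R]
    [AddCommGroup V] [Module R V] [AddCommGroup W] [Module R W] [Module.Finite R W]
    (φ : V →ₗ[R] W) (hlt : Module.finrank R W < Module.finrank R V) : ∃ x, x ≠ 0 ∧ φ x = 0 := by
  by_contra! hinj
  refine hlt.not_ge (LinearMap.finrank_le_finrank_of_injective (f := φ) ?_)
  exact (injective_iff_map_eq_zero φ).2 fun x hx => of_not_not fun hne => hinj x hne hx

theorem finrank_ker_add_one_of_surjective {R V : Type*} [CommRing R] [IsDomain R]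
    [AddCommGroup V] [Module R V] [Module.Finite R V] {φ : V →ₗ[R] R}
    (hφ : Function.Surjective φ) : Module.finrank R (LinearMap.ker φ) + 1 = Module.finrank R V := by
  rw [← (LinearMap.ker φ).finrank_quotient_add_finrank,
    (φ.quotKerEquivOfSurjective hφ).finrank_eq, Module.finrank_self, add_comm]

namespace HermitianForm

/-! ### Odd unimodular lattices of signature `(1, n)` -/

section Isotropic

variable {R : Subalgebra ℤ ℂ} {V : Type u} [AddCommGroup V] [Module R V] {h : HermitianForm R V}

theorem Lorentzian.exists_isotropic_of_three_le [IsNormEuclidean R] (H : h.Lorentzian)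
    (hrank : 3 ≤ Module.finrank R V) : ∃ e, e ≠ 0 ∧ h e e = 0 := by
  obtain ⟨v, hv, hneg⟩ := H
  obtain ⟨u, hu0, hvu⟩ := exists_ne_zero_and_apply_eq_zero (h v)
    (by rw [Module.finrank_self]; omega)
  obtain ⟨w, hw0, hw⟩ := exists_ne_zero_and_apply_eq_zero ((h v).prod (h u))
    (by rw [Module.finrank_prod, Module.finrank_self]; omega)
  obtain ⟨hvw, huw⟩ := Prod.mk.inj hw
  have hu := hneg u hvu hu0
  have hw := hneg w hvw hw0
  obtain ⟨x, y, z, hz, hxyz⟩ := represents_of_pos (R := R) (a := h.sq v * -h.sq u)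
    (b := h.sq v * -h.sq w) (mul_pos hv (neg_pos.2 hu)) (mul_pos hv (neg_pos.2 hw))
  set t := x • v + (h.sq v * y) • u with ht
  have hwt : h w t = 0 := by
    simp only [ht, map_add, map_smul, h.apply_eq_zero_comm.1 hvw, h.apply_eq_zero_comm.1 huw,
      smul_zero, add_zero]
  refine ⟨(1 : R) • t + (h.sq v * z) • w, fun h0 => ?_, ?_⟩
  · have hww : h.sq v * z * h w w = 0 := by
      simpa only [map_add, map_smul, hwt, smul_eq_mul, mul_zero, zero_add, map_zero]
        using congrArg (h w) h0
    simp only [← h.coe_sq, mul_eq_zero, Int.cast_eq_zero, hv.ne', hw.ne, hz, or_false] at hww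
  · have hsq : h.sq ((1 : R) • t + (h.sq v * z) • w) = 0 := by
      rw [h.sq_smul_add_smul _ _ (h.apply_eq_zero_comm.1 hwt), h.sq_smul_add_smul _ _ hvu]
      simp only [nrm_mul, nrm_intCast, nrm_one]
      linear_combination h.sq v * hxyz
    rw [← h.coe_sq, hsq, Int.cast_zero]

end Isotropic

section RankTwo

variable {R : Subalgebra ℤ ℂ} [IsConjStable R] {V : Type u} [AddCommGroup V] [Module R V]
  {h : HermitianForm R V}

theorem coe_det_gram_fin_two (b : Module.Basis (Fin 2) R V) :
    ((h.sq (b 0) * h.sq (b 1) - nrm (h (b 0) (b 1)) : ℤ) : R) = (h.gram b).det := by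
  rw [Matrix.det_fin_two]
  push_cast
  simp only [gram_apply, coe_sq, coe_nrm, cj_apply]

/-- Completing the square in a binary Hermitian form. -/
theorem sq_mul_sq_eq_of_basis_fin_two (b : Module.Basis (Fin 2) R V) (x : V) :
    h.sq (b 0) * h.sq x = nrm (h (b 0) x) +
      (h.sq (b 0) * h.sq (b 1) - nrm (h (b 0) (b 1))) * nrm (b.repr x 1) := by
  apply Int.cast_injective (α := R)
  have hx : x = b.repr x 0 • b 0 + b.repr x 1 • b 1 := by
    rw [← Fin.sum_univ_two (f := fun i => b.repr x i • b i), b.sum_repr]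
  generalize b.repr x 0 = c, b.repr x 1 = d at hx ⊢
  subst hx
  push_cast
  simp only [coe_nrm, coe_sq, map_add, map_smul, smul_eq_mul, map_add_left, smul_left, map_mul,
    cj_apply]
  ring

theorem Lorentzian.det_neg (H : h.Lorentzian) (b : Module.Basis (Fin 2) R V)
    (hb : h.sq (b 0) ≠ 0) : h.sq (b 0) * h.sq (b 1) - nrm (h (b 0) (b 1)) < 0 := by
  by_contra! hdet
  have hnonneg : ∀ x, 0 ≤ h.sq (b 0) * h.sq x := fun x =>
    sq_mul_sq_eq_of_basis_fin_two (h := h) b x ▸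
      add_nonneg (nrm_nonneg _) (mul_nonneg hdet (nrm_nonneg _))
  obtain ⟨v, hv, hneg⟩ := H
  obtain ⟨u, hu0, hvu⟩ := exists_ne_zero_and_apply_eq_zero (h v)
    (by rw [Module.finrank_self, Module.finrank_eq_card_basis b, Fintype.card_fin]; omega)
  have hb_pos : 0 < h.sq (b 0) := lt_of_le_of_ne (nonneg_of_mul_nonneg_left (hnonneg v) hv) hb.symm
  exact (hneg u hvu hu0).not_ge (nonneg_of_mul_nonneg_right (hnonneg u) hb_pos)

theorem Lorentzian.exists_isotropic_of_rank_two [Module.Free R V] [Module.Finite R V]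
    (H : h.Lorentzian) (P : h.Perfect 1) (hrank : Module.finrank R V = 2) :
    ∃ e, e ≠ 0 ∧ h e e = 0 := by
  let b : Module.Basis (Fin 2) R V := Module.finBasisOfFinrankEq R V hrank
  by_cases hb : h.sq (b 0) = 0
  · exact ⟨b 0, b.ne_zero 0, by rw [← h.coe_sq, hb, Int.cast_zero]⟩
  have hdet : h.sq (b 0) * h.sq (b 1) - nrm (h (b 0) (b 1)) = -1 := by
    have hunit := P.isUnit_det_gram b
    rw [← coe_det_gram_fin_two, isUnit_iff_nrm_eq_one, nrm_intCast, sq_eq_one_iff] at hunit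
    have := H.det_neg b hb
    omega
  refine ⟨(1 - h (b 0) (b 1)) • b 0 + (h.sq (b 0) : R) • b 1, fun h0 => hb ?_, ?_⟩
  · have hcoord := congrArg (b.coord 1) h0
    simpa only [map_add, map_smul, Module.Basis.coord_apply, b.repr_self, smul_eq_mul,
      Finsupp.single_eq_same, Finsupp.single_eq_of_ne one_ne_zero, mul_zero, zero_add, mul_one,
      map_zero, Int.cast_eq_zero] using hcoord
  · replace hdet := congrArg (Int.cast (R := R)) hdet
    push_cast [coe_nrm, coe_sq, cj_apply] at hdet
    simp only [map_add, map_smul, smul_eq_mul, map_add_left, smul_left, map_sub, map_one,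
      cj_apply, coe_sq]
    linear_combination h (b 0) (b 0) * hdet

end RankTwo

section Odd

variable {R : Subalgebra ℤ ℂ} [IsConjStable R]

theorem exists_intCast_eq_trace_or_one_add_trace (n : ℤ) :
    ∃ a : R, (n : R) = a + cj a ∨ (n : R) = 1 + (a + cj a) := by
  obtain ⟨m, rfl | rfl⟩ := n.even_or_odd'
  · exact ⟨m, .inl (by rw [map_intCast]; push_cast; ring)⟩
  · exact ⟨m, .inr (by rw [map_intCast]; push_cast; ring)⟩

variable {V : Type u} [AddCommGroup V] [Module R V] {h : HermitianForm R V}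

/-- Some value `v ⋆ v` is one more than a trace `a + cj a`. This is automatic if `1` is a trace, as
in the Eisenstein integers. -/
def IsOdd (h : HermitianForm R V) : Prop := ∃ (v : V) (a : R), h v v = 1 + (a + cj a)

theorem IsOdd.exists_apply_eq_one (O : h.IsOdd) {e f : V} (hef : h e f = 1) :
    ∃ (f' : V) (a : R), h e f' = 1 ∧ h f' f' = 1 + (a + cj a) := by
  obtain ⟨a, ha | ha⟩ := exists_intCast_eq_trace_or_one_add_trace (R := R) (h.sq f)
  swap
  · exact ⟨f, a, hef, h.coe_sq f ▸ ha⟩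
  obtain ⟨v, d, hv⟩ := O
  set c := h e v with hc
  have hew : h e (v - c • f) = 0 := by rw [map_sub, map_smul, hef, smul_eq_mul, mul_one, sub_self]
  refine ⟨f + (v - c • f), a + d + nrm c * a - c * h v f + h f (v - c • f),
    by rw [map_add, hef, hew, add_zero], ?_⟩
  rw [coe_sq] at ha
  simp only [map_add_left, sub_left, smul_left, map_add, map_sub, map_smul, smul_eq_mul, map_mul,
    hv, ha, coe_nrm, cj_cj, cj_apply]
  ring

theorem exists_isotropic_pair_of_isotropic [IsPrincipalIdealRing R] (H : h.Lorentzian)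
    (P : h.Perfect 1) {e₀ : V} (he₀ : e₀ ≠ 0) (hiso : h e₀ e₀ = 0) :
    ∃ e f, h e e = 0 ∧ h e f = 1 := by
  obtain ⟨c, e, f, rfl, hef⟩ := P.exists_smul_eq_and_apply_eq one_ne_zero H.nondegenerate he₀
  refine ⟨e, f, ?_, hef⟩
  have hc : c ≠ 0 := by
    rintro rfl
    exact he₀ (zero_smul R e)
  rw [map_smul, smul_left, smul_eq_mul] at hiso
  simpa only [mul_eq_zero, hc, cj_eq_zero, false_or] using hiso

theorem exists_orthogonal_units_of_isotropic {e f : V} {a : R} (he : h e e = 0)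
    (hef : h e f = 1) (hff : h f f = 1 + (a + cj a)) :
    ∃ f' g, h f' f' = -1 ∧ h g g = 1 ∧ h f' g = 0 := by
  have hfe : h f e = 1 := by rw [← h.cj_apply, hef, map_one]
  refine ⟨f - (1 + a) • e, f - a • e, ?_, ?_, ?_⟩ <;>
  · simp only [sub_left, smul_left, map_sub, map_smul, smul_eq_mul, map_add, map_one, he, hef,
      hfe, hff]
    ring

end Odd

section OrthogonalBasis

variable {R : Subalgebra ℤ ℂ} {V : Type u} [AddCommGroup V] [Module R V] {h : HermitianForm R V}

theorem exists_isotropic_pair [IsNormEuclidean R] [Module.Free R V] [Module.Finite R V]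
    (H : h.Lorentzian) (P : h.Perfect 1) (hrank : 2 ≤ Module.finrank R V) :
    ∃ e f, h e e = 0 ∧ h e f = 1 := by
  obtain ⟨e₀, he₀, hiso₀⟩ : ∃ e, e ≠ 0 ∧ h e e = 0 := by
    rcases hrank.eq_or_lt with h2 | h3
    · exact H.exists_isotropic_of_rank_two P h2.symm
    · exact H.exists_isotropic_of_three_le h3
  exact exists_isotropic_pair_of_isotropic H P he₀ hiso₀

theorem exists_orthogonal_units [IsNormEuclidean R] [Module.Free R V] [Module.Finite R V]
    (H : h.Lorentzian) (P : h.Perfect 1) (O : h.IsOdd) (hrank : 2 ≤ Module.finrank R V) :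
    ∃ f g, h f f = -1 ∧ h g g = 1 ∧ h f g = 0 := by
  obtain ⟨e, f₀, he, hef₀⟩ := exists_isotropic_pair H P hrank
  obtain ⟨f, a, hef, hff⟩ := O.exists_apply_eq_one hef₀
  exact exists_orthogonal_units_of_isotropic he hef hff

theorem Perfect.restrict_ker [IsConjStable R] (P : h.Perfect 1) {f : V} (hf : h f f = -1) :
    (h.restrict (LinearMap.ker (h f))).Perfect 1 := by
  let π : V →ₗ[R] LinearMap.ker (h f) :=
    (LinearMap.id + (h f).smulRight f).codRestrict _ fun x => by
      simp [hf]
  refine P.restrict_of_projection (π := π) (fun x => ?_) fun v x => ?_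
  · refine Subtype.ext ?_
    change x.1 + h f x.1 • f = x.1
    rw [LinearMap.mem_ker.1 x.2, zero_smul, add_zero]
  · change h (v + h f v • f) x.1 = _
    rw [map_add_left, smul_left, LinearMap.mem_ker.1 x.2, mul_zero, add_zero]

theorem Lorentzian.gram_eq_one_of_rank_one [IsConjStable R] (H : h.Lorentzian) (P : h.Perfect 1)
    (b : Module.Basis (Fin 1) R V) : h.gram b = 1 := by
  have hunit := P.isUnit_det_gram b
  rw [Matrix.det_fin_one, gram_apply, ← coe_sq, isUnit_iff_nrm_eq_one, nrm_intCast,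
    sq_eq_one_iff] at hunit
  have hpos : 0 < h.sq (b 0) := by
    obtain ⟨v, hv, -⟩ := H
    rw [← b.sum_repr v, Fin.sum_univ_one, sq_smul] at hv
    exact pos_of_mul_pos_right hv (nrm_nonneg _)
  ext i j : 2
  rw [Subsingleton.elim i 0, Subsingleton.elim j 0, gram_apply, Matrix.one_apply_eq, ← coe_sq,
    show h.sq (b 0) = 1 by omega, Int.cast_one]

theorem exists_gram_eq_diagonal_cons [IsConjStable R] {f : V} (hf : h f f = -1) {n : ℕ}
    {b : Module.Basis (Fin n) R (LinearMap.ker (h f))} {d : Fin n → R}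
    (hb : (h.restrict _).gram b = Matrix.diagonal d) :
    ∃ b' : Module.Basis (Fin (n + 1)) R V,
      h.gram b' = Matrix.diagonal (Fin.cons (-1) d : Fin (n + 1) → R) := by
  refine ⟨Module.Basis.mkFinCons f b (fun c x hx h0 => ?_) fun z => ⟨h f z, ?_⟩, ?_⟩
  · have hc := congrArg (h f) h0
    rwa [map_add, map_smul, hf, LinearMap.mem_ker.1 hx, add_zero, smul_eq_mul, mul_neg_one,
      map_zero, neg_eq_zero] at hc
  · rw [LinearMap.mem_ker, map_add, map_smul, hf, smul_eq_mul, mul_neg_one, add_neg_cancel]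
  · have hfb : ∀ i, h f (b i) = 0 := fun i => (b i).2
    have hbb : ∀ i j, h (b i) (b j) = Matrix.diagonal d i j := fun i j => by
      rw [← hb, gram_apply, restrict_apply]
    ext i j : 2
    rw [gram_apply, Module.Basis.coe_mkFinCons]
    refine Fin.cases ?_ (fun i => ?_) i <;> refine Fin.cases ?_ (fun j => ?_) j
    · simp [hf]
    · simp [hfb, (Fin.succ_ne_zero _).symm]
    · simp [h.apply_eq_zero_comm.1 (hfb _), Fin.succ_ne_zero]
    · simp [hbb, Matrix.diagonal_apply]

theorem exists_gram_eq_diagonal [IsNormEuclidean R] (n : ℕ) :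
    ∀ {V : Type u} [AddCommGroup V] [Module R V] [Module.Free R V] [Module.Finite R V]
      {h : HermitianForm R V}, h.Lorentzian → h.Perfect 1 → h.IsOdd →
      Module.finrank R V = n + 1 → ∃ b : Module.Basis (Fin (n + 1)) R V,
        h.gram b = Matrix.diagonal fun i => if i = Fin.last n then 1 else -1 := by
  induction n with
  | zero =>
    intro V _ _ _ _ h H P _ hrank
    refine ⟨Module.finBasisOfFinrankEq R V hrank, ?_⟩
    rw [H.gram_eq_one_of_rank_one P, ← Matrix.diagonal_one]
    exact congrArg _ (funext fun i => (if_pos (Subsingleton.elim i _)).symm)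
  | succ n ih =>
    intro V _ _ _ _ h H P O hrank
    obtain ⟨f, g, hf, hg, hfg⟩ := exists_orthogonal_units H P O (by omega)
    have hg_pos : 0 < h.sq g := by
      rw [sq_eq_iff.2 (hg.trans Int.cast_one.symm)]
      exact one_pos
    have hf_surj : Function.Surjective (h f) := fun c =>
      ⟨(-c) • f, by rw [map_smul, hf, smul_eq_mul, neg_mul_neg, mul_one]⟩
    obtain ⟨b, hb⟩ := ih (H.restrict (N := LinearMap.ker (h f)) hfg hg_pos) (P.restrict_ker hf)
      ⟨⟨g, hfg⟩, 0, by rw [restrict_apply, hg, map_zero, add_zero, add_zero]⟩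
      (Nat.succ_injective ((finrank_ker_add_one_of_surjective hf_surj).trans hrank))
    obtain ⟨b', hb'⟩ := exists_gram_eq_diagonal_cons hf hb
    refine ⟨b', hb'.trans (congrArg _ (funext fun i => ?_))⟩
    refine Fin.cases ?_ (fun i => ?_) i
    · rw [Fin.cons_zero, if_neg Fin.last_pos.ne]
    · rw [Fin.cons_succ, ← Fin.succ_last]
      exact if_congr (Fin.succ_inj).symm rfl rfl

theorem isometric_of_gram_eq [IsConjStable R] {W : Type v} [AddCommGroup W] [Module R W]
    {h' : HermitianForm R W} {ι : Type*} [Finite ι] {b : Module.Basis ι R V}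
    {b' : Module.Basis ι R W} (hb : h.gram b = h'.gram b') : Isometric h h' := by
  have := Fintype.ofFinite ι
  refine ⟨b.equiv b' (Equiv.refl _), fun x y => ?_⟩
  rw [← b.sum_repr x, ← b.sum_repr y]
  simp only [map_sum, map_smul, Module.Basis.equiv_apply, Equiv.refl_apply, smul_eq_mul,
    sum_left, smul_left, ← gram_apply, hb]

theorem isometric_of_isOdd [IsNormEuclidean R] {W : Type v} [AddCommGroup W] [Module R W]
    [Module.Free R V] [Module.Finite R V] [Module.Free R W] [Module.Finite R W]
    {h' : HermitianForm R W} (H : h.Lorentzian) (P : h.Perfect 1) (O : h.IsOdd)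
    (H' : h'.Lorentzian) (P' : h'.Perfect 1) (O' : h'.IsOdd)
    (hrank : Module.finrank R V = Module.finrank R W) (hpos : 0 < Module.finrank R V) :
    Isometric h h' := by
  obtain ⟨n, hn⟩ := Nat.exists_eq_succ_of_ne_zero hpos.ne'
  obtain ⟨b, hb⟩ := exists_gram_eq_diagonal n H P O hn
  obtain ⟨b', hb'⟩ := exists_gram_eq_diagonal n H' P' O' (hrank ▸ hn)
  exact isometric_of_gram_eq (hb.trans hb'.symm)

end OrthogonalBasis

end HermitianForm

/-! ### Transvections and Lagrangian submodules -/

/-- The arithmetic of the element `1 + ζ` of `ℤ[ζ]`, for `ζ` a primitive root of unity of order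
`6`, `4` or `3`; it has norm `p = 3`, `2` or `1` respectively. -/
structure IsModulus {R : Subalgebra ℤ ℂ} [IsConjStable R] (α : R) (p : ℤ) : Prop where
  eq_one_or_two_or_three : p = 1 ∨ p = 2 ∨ p = 3
  mul_cj : α * cj α = p
  add_cj : α + cj α = p
  exists_dvd_sub_intCast : ∀ c : R, ∃ n : ℤ, α ∣ c - n

section Modulus

variable {R : Subalgebra ℤ ℂ} [IsConjStable R] {α : R} {p : ℤ}

namespace IsModulus

theorem pos (hα : IsModulus α p) : 0 < p := by
  have := hα.eq_one_or_two_or_three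
  omega

theorem ne_zero (hα : IsModulus α p) : α ≠ 0 := by
  rintro rfl
  have hp := hα.mul_cj
  rw [zero_mul, eq_comm, Int.cast_eq_zero] at hp
  exact hα.pos.ne' hp

theorem dvd_intCast_self (hα : IsModulus α p) : α ∣ (p : R) := ⟨cj α, hα.mul_cj.symm⟩

/-- `α + cj α = α * cj α` says that `(α - 1) * (cj α - 1) = 1`, so `α` and `cj α` are associated. -/
theorem dvd_cj_self (hα : IsModulus α p) : α ∣ cj α :=
  ⟨cj α - 1, by linear_combination hα.add_cj - hα.mul_cj⟩

theorem dvd_cj_iff (hα : IsModulus α p) {c : R} : α ∣ cj c ↔ α ∣ c := by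
  have dvd_cj : ∀ c : R, α ∣ c → α ∣ cj c := fun c hc =>
    hα.dvd_cj_self.trans (map_dvd cj hc)
  exact ⟨fun hc => by simpa only [cj_cj] using dvd_cj _ hc, dvd_cj c⟩

theorem dvd_intCast_iff (hα : IsModulus α p) {n : ℤ} : α ∣ (n : R) ↔ p ∣ n := by
  refine ⟨?_, fun hn => hα.dvd_intCast_self.trans (map_dvd (Int.castRingHom R) hn)⟩
  rintro ⟨d, hd⟩
  have hnorm : p ∣ n ^ 2 := ⟨nrm d, by
    rw [← nrm_intCast (R := R), hd, nrm_mul, nrm_eq_iff.2 hα.mul_cj]⟩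
  rcases hα.eq_one_or_two_or_three with rfl | rfl | rfl
  · exact one_dvd n
  · exact Int.prime_two.dvd_of_dvd_pow hnorm
  · exact Int.prime_three.dvd_of_dvd_pow hnorm

theorem dvd_or_dvd_sub_one_or_dvd_add_one (hα : IsModulus α p) (c : R) :
    α ∣ c ∨ α ∣ c - 1 ∨ α ∣ c + 1 := by
  obtain ⟨n, hn⟩ := hα.exists_dvd_sub_intCast c
  have dvd_sub_of : ∀ m : ℤ, p ∣ n - m → α ∣ c - m := fun m hm => by
    have := dvd_add hn (hα.dvd_intCast_iff.2 hm)
    rwa [Int.cast_sub, sub_add_sub_cancel] at this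
  have hcases : p ∣ n - 0 ∨ p ∣ n - 1 ∨ p ∣ n - (-1) := by
    rcases hα.eq_one_or_two_or_three with rfl | rfl | rfl <;> omega
  refine hcases.imp (fun h0 => ?_) (Or.imp (fun h1 => ?_) fun h1 => ?_)
  · simpa using dvd_sub_of _ h0
  · simpa using dvd_sub_of _ h1
  · simpa using dvd_sub_of _ h1

/-- If `r ⋆ r = n` is `-2` modulo `α`, the transvection `x ↦ x + c (r ⋆ x) r` is unitary for a
suitable `c ≡ 1`, after `n` is changed by a trace from `pR`. -/
theorem exists_transvection_coeff (hα : IsModulus α p) {n : ℤ} (hn : α ∣ (n : R) + 2) :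
    ∃ a c : R, α ∣ c - 1 ∧ c + cj c + c * cj c * (n + ((p : R) * a + cj ((p : R) * a))) = 0 := by
  obtain ⟨m, hm⟩ : p ∣ n + 2 := hα.dvd_intCast_iff.1 (by exact_mod_cast hn)
  obtain rfl : n = p * m - 2 := by omega
  have hadd := hα.add_cj
  rcases hα.eq_one_or_two_or_three with rfl | rfl | rfl
  · refine ⟨m * α - m, 1, by simp, ?_⟩
    simp only [map_sub, map_mul, map_one, map_intCast]
    push_cast at hadd ⊢
    linear_combination (m : R) * hadd
  · obtain ⟨d, rfl | rfl⟩ := m.even_or_odd'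
    · refine ⟨-d, 1, by simp, ?_⟩
      simp only [map_neg, map_mul, map_one, map_intCast]
      push_cast
      ring
    · refine ⟨-d, 1 - α, by simp, ?_⟩
      simp only [map_neg, map_sub, map_mul, map_one, map_intCast]
      push_cast at hadd ⊢
      linear_combination -hadd
  · refine ⟨m * α - 2 * m, 1, by simp, ?_⟩
    simp only [map_sub, map_mul, map_one, map_intCast, map_ofNat]
    push_cast at hadd ⊢
    linear_combination (3 * m : R) * hadd

end IsModulus

end Modulus

namespace HermitianForm

variable {R : Subalgebra ℤ ℂ} {V : Type u} [AddCommGroup V] [Module R V] {h : HermitianForm R V}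

section Transvection

variable [IsConjStable R]

theorem transvection_comp_transvection_eq_id {r : V} {c : R}
    (H : c + cj c + c * cj c * h r r = 0) :
    LinearMap.transvection (h r) (c • r) ∘ₗ LinearMap.transvection (h r) (cj c • r) =
      LinearMap.id := by
  rw [LinearMap.transvection.comp_smul_smul, show c + cj c + cj c * h r r * c = 0 by
    linear_combination H, zero_smul, LinearMap.transvection.of_right_eq_zero]

theorem apply_transvection_transvection {r : V} {c : R} (H : c + cj c + c * cj c * h r r = 0)
    (x y : V) : h (LinearMap.transvection (h r) (c • r) x)
      (LinearMap.transvection (h r) (c • r) y) = h x y := by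
  simp only [LinearMap.transvection.apply, map_add, map_add_left, map_smul, smul_left,
    smul_eq_mul, cj_apply]
  linear_combination h x r * h r y * H

/-- The transvection or complex reflection `x ↦ x + c (r ⋆ x) r` as an element of the unitary
group. -/
def transvection (r : V) (c : R) (H : c + cj c + c * cj c * h r r = 0) : h.isometryGroup :=
  have H' : cj c + cj (cj c) + cj c * cj (cj c) * h r r = 0 := by
    rw [cj_cj]
    linear_combination H
  ⟨LinearEquiv.ofLinearMap (LinearMap.transvection (h r) (c • r))
    (LinearMap.transvection (h r) (cj c • r)) (transvection_comp_transvection_eq_id H)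
    (by simpa only [cj_cj] using transvection_comp_transvection_eq_id H'),
    apply_transvection_transvection H⟩

theorem transvection_apply {r : V} {c : R} (H : c + cj c + c * cj c * h r r = 0) (x : V) :
    (transvection r c H).1 x = x + (h r x * c) • r := by
  rw [mul_smul]
  rfl

theorem exists_apply_add_smul_dvd {α : R} {p : ℤ} (hα : IsModulus α p) {e f : V}
    (hef : h e f = 1) (r : V) : ∃ y, h e (r + α • y) ∣ α := by
  have happly : ∀ d : R, h e (r + α • (d • f)) = h e r + α * d := fun d => by
    simp only [map_add, map_smul, smul_eq_mul, hef, mul_one]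
  rcases hα.dvd_or_dvd_sub_one_or_dvd_add_one (h e r) with ⟨d, hd⟩ | ⟨d, hd⟩ | ⟨d, hd⟩
  · refine ⟨(1 - d) • f, dvd_of_eq ?_⟩
    rw [happly]
    linear_combination hd
  · refine ⟨(-d) • f, IsUnit.dvd ?_⟩
    rw [happly, show h e r + α * -d = 1 by linear_combination hd]
    exact isUnit_one
  · refine ⟨(-d) • f, IsUnit.dvd ?_⟩
    rw [happly, show h e r + α * -d = -1 by linear_combination hd]
    exact isUnit_one.neg

theorem dvd_apply_add_smul_sub {α : R} {p : ℤ} (hα : IsModulus α p) (x y z : V) :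
    α ∣ h (x + α • y) z - h x z := by
  rw [map_add_left, smul_left, add_sub_cancel_left]
  exact hα.dvd_cj_self.mul_right _

theorem dvd_sq_add_smul_sub {α : R} {p : ℤ} (hα : IsModulus α p) (x y : V) :
    α ∣ h (x + α • y) (x + α • y) - h x x := by
  rw [← sub_add_sub_cancel _ (h x (x + α • y))]
  refine dvd_add (dvd_apply_add_smul_sub hα x y _) ?_
  rw [map_add, add_sub_cancel_left, map_smul]
  exact dvd_mul_right _ _

/-- Changing `r` by a multiple of the isotropic vector `α • e` changes `r ⋆ r` by a trace. -/
theorem exists_transvection_add_smul {α : R} {p : ℤ} (hα : IsModulus α p) {e f : V}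
    (he : h e e = 0) (hef : h e f = 1) {r : V} (hr : α ∣ h r r + 2) :
    ∃ (y : V) (c : R), α ∣ c - 1 ∧
      c + cj c + c * cj c * h (r + α • y) (r + α • y) = 0 := by
  obtain ⟨y, b, hb⟩ := exists_apply_add_smul_dvd hα hef r
  have hr' := dvd_add (dvd_sq_add_smul_sub (h := h) hα r y) hr
  rw [← add_assoc, sub_add_cancel, ← coe_sq] at hr'
  obtain ⟨a, c, hc, hcoeff⟩ := hα.exists_transvection_coeff hr'
  refine ⟨y + (cj b * a) • e, c, hc, ?_⟩
  have hsplit : r + α • (y + (cj b * a) • e) = (r + α • y) + (α * cj b * a) • e := by module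
  rw [coe_sq, ← hα.mul_cj] at hcoeff
  rw [hsplit, ← hcoeff]
  generalize r + α • y = s at hb
  have hb' : cj α = cj b * h s e := by rw [hb, map_mul, cj_apply, mul_comm]
  simp only [map_add_left, smul_left, map_add, map_smul, smul_eq_mul, he, map_mul, cj_cj]
  rw [hb']
  simp only [hb]
  ring

end Transvection

section Lagrangian

/-- The submodule `P` is its own orthogonal complement modulo `α`. -/
def IsLagrangian (h : HermitianForm R V) (α : R) (P : Submodule R V) : Prop :=
  ∀ y, y ∈ P ↔ ∀ x ∈ P, α ∣ h y x

namespace IsLagrangian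

variable {α : R} {P Q : Submodule R V}

theorem dvd (hP : h.IsLagrangian α P) {x y : V} (hx : x ∈ P) (hy : y ∈ P) : α ∣ h x y :=
  (hP x).1 hx y hy

theorem eq_of_le (hP : h.IsLagrangian α P) (hQ : h.IsLagrangian α Q) (hle : P ≤ Q) : P = Q :=
  le_antisymm hle fun y hy => (hP y).2 fun _ hx => hQ.dvd hy (hle hx)

theorem map {W : Type v} [AddCommGroup W] [Module R W] {h' : HermitianForm R W}
    (hP : h.IsLagrangian α P) {g : V ≃ₗ[R] W} (hg : ∀ x y, h' (g x) (g y) = h x y) :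
    h'.IsLagrangian α (P.map (g : V →ₗ[R] W)) := by
  intro y
  obtain ⟨x, rfl⟩ := g.surjective y
  refine (g.injective.mem_set_image.trans (hP x)).trans ⟨?_, fun H z hz => ?_⟩
  · rintro H _ ⟨z, hz, rfl⟩
    exact (hg x z).symm ▸ H z hz
  · exact hg x z ▸ H (g z) ⟨z, hz, rfl⟩

variable [IsConjStable R] {p : ℤ}

theorem smul_mem (hP : h.IsLagrangian α P) (hα : IsModulus α p) (x : V) : α • x ∈ P :=
  (hP _).2 fun y _ => by
    rw [smul_left]
    exact hα.dvd_cj_self.mul_right _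

theorem exists_dvd_apply_sub_one (hQ : h.IsLagrangian α Q) (hα : IsModulus α p) {x : V}
    (hx : x ∉ Q) : ∃ y ∈ Q, α ∣ h x y - 1 := by
  rw [hQ x] at hx
  push Not at hx
  obtain ⟨y, hy, hxy⟩ := hx
  rcases (hα.dvd_or_dvd_sub_one_or_dvd_add_one _).resolve_left hxy with hsub | hadd
  · exact ⟨y, hy, hsub⟩
  · refine ⟨-y, Q.neg_mem hy, ?_⟩
    rwa [map_neg, ← neg_add', dvd_neg]

theorem mem_map_of_eq_add_smul (hP : h.IsLagrangian α P) (hα : IsModulus α p)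
    {g : h.isometryGroup} {x y z : V} (hx : x ∈ P) (hy : y = g.1 x + α • z) :
    y ∈ P.map (g.1 : V →ₗ[R] V) :=
  hy ▸ add_mem ⟨x, hx, rfl⟩ ((hP.map g.2).smul_mem hα z)

theorem le_map_transvection (hP : h.IsLagrangian α P) (hα : IsModulus α p) {D : Submodule R V}
    (hD : D ≤ P) {r : V} {c : R} (H : c + cj c + c * cj c * h r r = 0)
    (hr : ∀ d ∈ D, α ∣ h r d) : D ≤ P.map ((transvection r c H).1 : V →ₗ[R] V) := by
  intro d hd
  obtain ⟨m, hm⟩ := hr d hd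
  refine hP.mem_map_of_eq_add_smul hα (hD hd) (z := (-(m * c)) • r) ?_
  rw [transvection_apply, hm]
  module

theorem mem_map_transvection (hP : h.IsLagrangian α P) (hα : IsModulus α p) {x y z : V}
    (hx : x ∈ P) {c : R} (H : c + cj c + c * cj c * h (x - y + α • z) (x - y + α • z) = 0)
    (hc : α ∣ c - 1) (hxy : α ∣ h (x - y + α • z) x + 1) :
    y ∈ P.map ((transvection (x - y + α • z) c H).1 : V →ₗ[R] V) := by
  obtain ⟨m, hm⟩ := hxy
  obtain ⟨n, hn⟩ := hc
  refine hP.mem_map_of_eq_add_smul hα hx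
    (z := (n - m - α * m * n) • (x - y + α • z) + z) ?_
  rw [transvection_apply, show h (x - y + α • z) x * c = -1 + α * (m - n + α * m * n) by
    linear_combination c * hm + (α * m - 1) * hn]
  module

theorem exists_inf_lt_map_inf (hP : h.IsLagrangian α P) (hQ : h.IsLagrangian α Q)
    (hα : IsModulus α p) {e f : V} (he : h e e = 0) (hef : h e f = 1) {x : V} (hx : x ∈ P)
    (hxQ : x ∉ Q) : ∃ g : h.isometryGroup, P ⊓ Q < P.map (g.1 : V →ₗ[R] V) ⊓ Q := by
  obtain ⟨y, hy, hxy⟩ := hQ.exists_dvd_apply_sub_one hα hxQ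
  have hyx : α ∣ h y x - 1 := by
    rwa [← hα.dvd_cj_iff, map_sub, h.cj_apply, map_one]
  have hyP : y ∉ P := fun hyP => hxQ ((hQ x).2 fun z _ => by
    have hα_one : α ∣ 1 := by simpa only [sub_sub_cancel] using dvd_sub (hP.dvd hx hyP) hxy
    exact hα_one.trans (one_dvd _))
  have hnorm : α ∣ h (x - y) (x - y) + 2 := by
    rw [show h (x - y) (x - y) + 2 = h x x + h y y - (h x y - 1) - (h y x - 1) by
      simp only [sub_left, map_sub]
      ring]
    exact dvd_sub (dvd_sub (dvd_add (hP.dvd hx hx) (hQ.dvd hy hy)) hxy) hyx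
  obtain ⟨z, c, hc, H⟩ := exists_transvection_add_smul hα he hef hnorm
  have hrx : α ∣ h (x - y + α • z) x + 1 := by
    have := dvd_sub (dvd_add (dvd_apply_add_smul_sub (h := h) hα (x - y) z x) (hP.dvd hx hx)) hyx
    rwa [sub_left, show ∀ a b c : R, a - (b - c) + b - (c - 1) = a + 1 by intros; ring] at this
  have hrD : ∀ d ∈ P ⊓ Q, α ∣ h (x - y + α • z) d := fun d hd => by
    have := dvd_add (dvd_apply_add_smul_sub (h := h) hα (x - y) z d)
      (dvd_sub (hP.dvd hx hd.1) (hQ.dvd hy hd.2))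
    rwa [sub_left, sub_add_cancel] at this
  have hle := le_inf (hP.le_map_transvection hα inf_le_left H hrD) inf_le_right
  have hyT := hP.mem_map_transvection hα hx H hc hrx
  exact ⟨_, hle.lt_of_not_ge fun hge => hyP (hge ⟨hyT, hy⟩).1⟩

/-- An isometry maximizing the intersection of the image of `P` with `Q` maps `P` to `Q`. -/
theorem exists_map_eq [IsNoetherian R V] (hP : h.IsLagrangian α P) (hQ : h.IsLagrangian α Q)
    (hα : IsModulus α p) {e f : V} (he : h e e = 0) (hef : h e f = 1) :
    ∃ g : h.isometryGroup, P.map (g.1 : V →ₗ[R] V) = Q := by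
  obtain ⟨D, ⟨g, rfl⟩, hmax⟩ := (wellFounded_gt (α := Submodule R V)).has_min
    (Set.range fun g : h.isometryGroup => P.map (g.1 : V →ₗ[R] V) ⊓ Q) ⟨_, 1, rfl⟩
  refine ⟨g, (hP.map g.2).eq_of_le hQ fun x hx => ?_⟩
  by_contra hxQ
  obtain ⟨t, hlt⟩ := (hP.map g.2).exists_inf_lt_map_inf hQ hα he hef hx hxQ
  refine hmax _ ⟨t * g, rfl⟩ (hlt.trans_eq ?_)
  rw [← Submodule.map_comp]
  rfl

end IsLagrangian

end Lagrangian

end HermitianForm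

section Gluing

variable {R : Subalgebra ℤ ℂ} {V X : Type u} {W Y : Type v} [AddCommGroup V] [Module R V]
  [AddCommGroup X] [Module R X] [AddCommGroup W] [Module R W] [AddCommGroup Y] [Module R Y]
  {h : HermitianForm R V} {k : HermitianForm R X} {h' : HermitianForm R W}
  {k' : HermitianForm R Y}

theorem isometric_of_map_range_eq {j : V →ₗ[R] X} (hj : Function.Injective j)
    (hjk : ∀ x y, k (j x) (j y) = h x y) {j' : W →ₗ[R] Y} (hj' : Function.Injective j')
    (hjk' : ∀ x y, k' (j' x) (j' y) = h' x y) {φ : X ≃ₗ[R] Y}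
    (hφ : ∀ x y, k' (φ x) (φ y) = k x y)
    (hrange : (LinearMap.range j).map (φ : X →ₗ[R] Y) = LinearMap.range j') :
    Isometric h h' := by
  let F : V ≃ₗ[R] W := LinearEquiv.ofInjective j hj ≪≫ₗ φ.submoduleMap _ ≪≫ₗ
    LinearEquiv.ofEq _ _ hrange ≪≫ₗ (LinearEquiv.ofInjective j' hj').symm
  have hF : ∀ x, j' (F x) = φ (j x) := fun x =>
    congrArg Subtype.val ((LinearEquiv.ofInjective j' hj').apply_symm_apply _)
  exact ⟨F, fun x y => by rw [← hjk', hF, hF, hφ, hjk]⟩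

end Gluing

namespace HermitianForm

/-! ### Uniqueness of modular lattices of signature `(1, n)` -/

section Hull

variable {R : Subalgebra ℤ ℂ} [IsConjStable R] {V : Type u} [AddCommGroup V] [Module R V]
  {h : HermitianForm R V}

theorem exists_eq_intCast_mul {n : ℤ} (hn : n ≠ 0) (H : ∀ x y, (n : R) ∣ h x y) :
    ∃ k : HermitianForm R V, ∀ x y, h x y = n * k x y := by
  have hn' : (n : R) ≠ 0 := Int.cast_ne_zero.2 hn
  choose k hk using fun x => exists_eq_smul_of_forall_dvd hn' (H x)
  have hmul : ∀ x y, h x y = n * k x y := fun x y => by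
    rw [hk, LinearMap.smul_apply, smul_eq_mul]
  refine ⟨⟨k, fun x y => congrArg Subtype.val (mul_left_cancel₀ hn' ?_ : cj (k y x) = k x y)⟩,
    hmul⟩
  rw [← hmul, ← h.cj_apply, hmul, map_mul, map_intCast]

theorem dvd_apply_of_mem_sup_span {n : ℤ} {X : Submodule R V} {y : V}
    (hX : ∀ x ∈ X, ∀ x' ∈ X, (n : R) ∣ h x x') (hyX : ∀ x ∈ X, (n : R) ∣ h y x)
    (hy : (n : R) ∣ h y y) :
    ∀ x ∈ X ⊔ R ∙ y, ∀ x' ∈ X ⊔ R ∙ y, (n : R) ∣ h x x' := by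
  have hXy : ∀ x ∈ X, (n : R) ∣ h x y := fun x hx => by
    simpa only [map_intCast, h.cj_apply] using map_dvd cj (hyX x hx)
  intro x hx x' hx'
  obtain ⟨v, hv, _, hw, rfl⟩ := Submodule.mem_sup.1 hx
  obtain ⟨a, rfl⟩ := Submodule.mem_span_singleton.1 hw
  obtain ⟨v', hv', _, hw', rfl⟩ := Submodule.mem_sup.1 hx'
  obtain ⟨a', rfl⟩ := Submodule.mem_span_singleton.1 hw'
  simp only [map_add_left, smul_left, map_add, map_smul, smul_eq_mul]
  exact dvd_add (dvd_add (hX v hv v' hv') ((hyX v' hv').mul_left _))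
    ((dvd_add (hXy v hv) (hy.mul_left _)).mul_left _)

theorem exists_isLagrangian_ge [IsNoetherian R V] {n : ℤ} (hsq : ∀ x, (n : R) ∣ h x x)
    {X₀ : Submodule R V} (hX₀ : ∀ x ∈ X₀, ∀ y ∈ X₀, (n : R) ∣ h x y) :
    ∃ X, X₀ ≤ X ∧ h.IsLagrangian n X := by
  obtain ⟨X, ⟨hX₀X, hX⟩, hmax⟩ := (wellFounded_gt (α := Submodule R V)).has_min
    {X | X₀ ≤ X ∧ ∀ x ∈ X, ∀ y ∈ X, (n : R) ∣ h x y} ⟨X₀, le_rfl, hX₀⟩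
  refine ⟨X, hX₀X, fun y => ⟨hX y, fun hy => ?_⟩⟩
  by_contra hyX
  exact hmax (X ⊔ R ∙ y)
    ⟨hX₀X.trans le_sup_left, dvd_apply_of_mem_sup_span hX hy (hsq y)⟩
    (left_lt_sup.2 (mt (Submodule.span_singleton_le_iff_mem y X).1 hyX))

theorem Lorentzian.of_eq_intCast_mul {n : ℤ} (hn : 0 < n) {k : HermitianForm R V}
    (hk : ∀ x y, h x y = n * k x y) (H : h.Lorentzian) : k.Lorentzian := by
  have hsq : ∀ x, h.sq x = n * k.sq x := fun x => by
    rw [sq_eq_iff, hk]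
    push_cast
    rw [coe_sq]
  obtain ⟨v, hv, hneg⟩ := H
  refine ⟨v, pos_of_mul_pos_right (hsq v ▸ hv) hn.le, fun y hy hy0 => ?_⟩
  have hneg_y := hneg y (by rw [hk, hy, mul_zero]) hy0
  rw [hsq] at hneg_y
  exact neg_of_mul_neg_right hneg_y hn.le

variable {α : R} {p : ℤ}

theorem Perfect.intCast_dvd_apply_self (P : h.Perfect α) (hα : IsModulus α p) (x : V) :
    (p : R) ∣ h x x := by
  have hdvd := P.1 x x
  rw [← coe_sq, hα.dvd_intCast_iff] at hdvd
  exact h.coe_sq x ▸ map_dvd (Int.castRingHom R) hdvd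

/-- If neither of two vectors `l`, `m` with `l ⋆ m = α` works, then `l + m` does, since the trace
of `α` is `p`. -/
theorem Perfect.exists_apply_self_eq [IsPrincipalIdealRing R] (P : h.Perfect α)
    (hα : IsModulus α p) (H : h.Lorentzian) :
    ∃ (x : V) (a : R), h x x = p * (1 + (a + cj a)) := by
  obtain ⟨v, hv⟩ : ∃ v : V, v ≠ 0 := by
    obtain ⟨v, hv, -⟩ := H
    exact ⟨v, fun h0 => hv.ne' (h0 ▸ h.sq_zero)⟩
  obtain ⟨-, l, m, -, hlm⟩ := P.exists_smul_eq_and_apply_eq hα.ne_zero H.nondegenerate hv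
  have hcases : ∀ x : V, ∃ a : R, h x x = p * (a + cj a) ∨ h x x = p * (1 + (a + cj a)) := by
    intro x
    have hdvd := P.1 x x
    rw [← coe_sq, hα.dvd_intCast_iff] at hdvd
    obtain ⟨n, hn⟩ := hdvd
    obtain ⟨a, ha⟩ := exists_intCast_eq_trace_or_one_add_trace (R := R) n
    refine ⟨a, ha.imp (fun ha => ?_) fun ha => ?_⟩ <;>
    · rw [← coe_sq, hn, ← ha]
      push_cast
      rfl
  obtain ⟨a, hl | hl⟩ := hcases l
  swap
  · exact ⟨l, a, hl⟩
  obtain ⟨b, hm | hm⟩ := hcases m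
  swap
  · exact ⟨m, b, hm⟩
  have hml : h m l = cj α := by rw [← h.cj_apply, hlm]
  refine ⟨l + m, a + b, ?_⟩
  simp only [map_add_left, map_add, hl, hm, hlm, hml]
  linear_combination hα.add_cj

theorem Perfect.smul_mem_of_isLagrangian (P : h.Perfect α) (hα : IsModulus α p)
    {X : Submodule R V} (hX : h.IsLagrangian p X) (x : V) : α • x ∈ X :=
  (hX _).2 fun y _ => by
    rw [smul_left, ← hα.mul_cj, mul_comm α]
    exact mul_dvd_mul_left _ (P.1 x y)

section Divided

variable {X : Submodule R V} {k : HermitianForm R X} {j : V →ₗ[R] X}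

theorem divided_apply_smul (hα : IsModulus α p) (hk : ∀ x y : X, h x y = p * k x y)
    (hj : ∀ x, (j x : V) = α • x) (x : X) (y : V) : cj α * k x (j y) = h x y := by
  refine mul_left_cancel₀ hα.ne_zero ?_
  rw [← mul_assoc, hα.mul_cj, ← hk, hj, map_smul, smul_eq_mul]

theorem divided_smul_smul (hα : IsModulus α p) (hk : ∀ x y : X, h x y = p * k x y)
    (hj : ∀ x, (j x : V) = α • x) (x y : V) : k (j x) (j y) = h x y := by
  refine mul_left_cancel₀ (cj_eq_zero.not.2 hα.ne_zero) ?_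
  rw [divided_apply_smul hα hk hj, hj, smul_left]

theorem Perfect.divided (P : h.Perfect α) (hα : IsModulus α p) (hX : h.IsLagrangian p X)
    (hk : ∀ x y : X, h x y = p * k x y) (hj : ∀ x, (j x : V) = α • x) : k.Perfect 1 := by
  refine ⟨fun _ _ => one_dvd _, fun φ => ?_⟩
  obtain ⟨u, hu⟩ := hα.dvd_cj_self
  obtain ⟨y, hy⟩ := P.2 (u • φ ∘ₗ j)
  have hyX : ∀ x : X, h y x = p * φ x := fun x => by
    rw [hy, LinearMap.smul_apply, LinearMap.smul_apply, LinearMap.comp_apply,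
      show j x = α • x from Subtype.ext (hj x), map_smul, ← hα.mul_cj, hu]
    simp only [smul_eq_mul]
    ring
  refine ⟨⟨y, (hX y).2 fun x hx => ⟨_, hyX ⟨x, hx⟩⟩⟩, LinearMap.ext fun x => ?_⟩
  rw [one_smul]
  exact mul_left_cancel₀ (Int.cast_ne_zero.2 hα.pos.ne') ((hk _ x).symm.trans (hyX x))

theorem Perfect.isLagrangian_range (P : h.Perfect α) (hα : IsModulus α p)
    (N : h.Nondegenerate) (hk : ∀ x y : X, h x y = p * k x y)
    (hj : ∀ x, (j x : V) = α • x) : k.IsLagrangian α (LinearMap.range j) := by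
  refine fun y => ⟨?_, fun hy => ?_⟩
  · rintro ⟨x, rfl⟩ _ ⟨z, rfl⟩
    rw [divided_smul_smul hα hk hj]
    exact P.1 x z
  · have hdvd : ∀ v, (p : R) ∣ h y v := fun v => by
      rw [← divided_apply_smul hα hk hj, ← hα.mul_cj, mul_comm α]
      exact mul_dvd_mul_left _ (hy _ ⟨v, rfl⟩)
    obtain ⟨φ, hφ⟩ := exists_eq_smul_of_forall_dvd (Int.cast_ne_zero.2 hα.pos.ne') hdvd
    obtain ⟨z, hz⟩ := P.2 φ
    refine ⟨z, Subtype.ext (N.ext_left (LinearMap.ext fun x => ?_))⟩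
    rw [hj, smul_left, hz, hφ, ← hα.mul_cj]
    simp only [LinearMap.smul_apply, smul_eq_mul]
    ring

end Divided

/-- On a submodule `X` that is Lagrangian modulo `p`, the form divided by `p` is unimodular, and
`x ↦ α • x` embeds the lattice in `X`. It is odd if `X` contains a suitable vector. -/
theorem Perfect.exists_unimodular_hull [IsPrincipalIdealRing R] [Module.Finite R V]
    [Module.Free R V] (P : h.Perfect α) (hα : IsModulus α p) (H : h.Lorentzian) :
    ∃ (X : Submodule R V) (k : HermitianForm R X) (j : V →ₗ[R] X), Function.Injective j ∧
      (∀ x y, k (j x) (j y) = h x y) ∧ k.Perfect 1 ∧ k.Lorentzian ∧ k.IsOdd ∧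
      k.IsLagrangian α (LinearMap.range j) ∧ Module.finrank R X = Module.finrank R V := by
  obtain ⟨x₀, a₀, hx₀⟩ := P.exists_apply_self_eq hα H
  have hspan : ∀ x ∈ R ∙ x₀, ∀ y ∈ R ∙ x₀, (p : R) ∣ h x y := by
    simpa only [bot_sup_eq] using dvd_apply_of_mem_sup_span (X := ⊥) (y := x₀)
      (by simp) (by simp) (P.intCast_dvd_apply_self hα x₀)
  obtain ⟨X, hx₀X, hX⟩ := exists_isLagrangian_ge (P.intCast_dvd_apply_self hα) hspan
  obtain ⟨k, hk⟩ := exists_eq_intCast_mul (h := h.restrict X) hα.pos.ne' fun x y =>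
    hX.dvd x.2 y.2
  let j : V →ₗ[R] X := (LinearMap.lsmul R V α).codRestrict X (P.smul_mem_of_isLagrangian hα hX)
  have hj : ∀ x, (j x : V) = α • x := fun _ => rfl
  have hj_inj : Function.Injective j := fun x y hxy =>
    smul_right_injective V hα.ne_zero (congrArg Subtype.val hxy)
  have hkH : k.Lorentzian := by
    obtain ⟨v, hv, -⟩ := id H
    refine Lorentzian.of_eq_intCast_mul hα.pos hk (H.restrict (j v).2 ?_)
    rw [hj, sq_smul]
    exact mul_pos (nrm_pos.2 hα.ne_zero) hv
  refine ⟨X, k, j, hj_inj, divided_smul_smul hα hk hj, P.divided hα hX hk hj, hkH, ?_,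
    P.isLagrangian_range hα H.nondegenerate hk hj, le_antisymm
      (LinearMap.finrank_le_finrank_of_injective X.injective_subtype)
      (LinearMap.finrank_le_finrank_of_injective hj_inj)⟩
  refine ⟨⟨x₀, (Submodule.span_singleton_le_iff_mem _ _).1 hx₀X⟩, a₀, ?_⟩
  exact mul_left_cancel₀ (Int.cast_ne_zero.2 hα.pos.ne') ((hk _ _).symm.trans hx₀)

end Hull

section Uniqueness

variable {R : Subalgebra ℤ ℂ} [IsNormEuclidean R] {V : Type u} {W : Type v} [AddCommGroup V]
  [Module R V] [Module.Free R V] [Module.Finite R V] [AddCommGroup W] [Module R W]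
  [Module.Free R W] [Module.Finite R W] {h : HermitianForm R V} {h' : HermitianForm R W}

theorem isometric_of_finrank_eq {α : R} {p : ℤ} (hα : IsModulus α p) (H : h.Lorentzian)
    (P : h.Perfect α) (H' : h'.Lorentzian) (P' : h'.Perfect α)
    (hrank : Module.finrank R V = Module.finrank R W) (h2 : 2 ≤ Module.finrank R V) :
    Isometric h h' := by
  obtain ⟨X, k, j, hj, hjk, kP, kH, kO, kL, kr⟩ := P.exists_unimodular_hull hα H
  obtain ⟨X', k', j', hj', hjk', kP', kH', kO', kL', kr'⟩ := P'.exists_unimodular_hull hα H'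
  obtain ⟨φ, hφ⟩ := isometric_of_isOdd kH kP kO kH' kP' kO' (by rw [kr, kr', hrank]) (by omega)
  obtain ⟨e, f, he, hef⟩ := exists_isotropic_pair kH' kP' (by omega)
  obtain ⟨g, hg⟩ := (kL.map hφ).exists_map_eq kL' hα he hef
  refine isometric_of_map_range_eq hj hjk hj' hjk' (φ := φ ≪≫ₗ g.1)
    (fun x y => (g.2 _ _).trans (hφ x y)) ?_
  rw [← hg, ← Submodule.map_comp]
  rfl

end Uniqueness

end HermitianForm

/-! ### Splitting off hyperbolic planes -/

section Isometric

variable {R : Subalgebra ℤ ℂ} {V : Type u} [AddCommGroup V] [Module R V] {h : HermitianForm R V}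
  {W : Type v} [AddCommGroup W] [Module R W] {h' : HermitianForm R W}

theorem Isometric.symm (I : Isometric h h') : Isometric h' h := by
  obtain ⟨f, hf⟩ := I
  exact ⟨f.symm, fun x y => by rw [← hf, f.apply_symm_apply, f.apply_symm_apply]⟩

theorem Isometric.trans {U : Type w} [AddCommGroup U] [Module R U] {h'' : HermitianForm R U}
    (I : Isometric h h') (J : Isometric h' h'') : Isometric h h'' := by
  obtain ⟨f, hf⟩ := I
  obtain ⟨g, hg⟩ := J
  exact ⟨f.trans g, fun x y => (hg _ _).trans (hf x y)⟩

namespace HermitianForm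

theorem IsNegDef.of_isometric (H : h.IsNegDef) (I : Isometric h h') : h'.IsNegDef := by
  obtain ⟨f, hf⟩ := I.symm
  intro x hx
  rw [← hf]
  exact H _ (f.map_ne_zero_iff.2 hx)

theorem Perfect.of_isometric {α : R} (P : h.Perfect α) (I : Isometric h h') : h'.Perfect α := by
  obtain ⟨f, hf⟩ := I.symm
  refine ⟨fun x y => hf x y ▸ P.1 _ _, fun φ => ?_⟩
  obtain ⟨y, hy⟩ := P.2 (φ ∘ₗ f.symm)
  refine ⟨f.symm y, LinearMap.ext fun x => ?_⟩
  rw [← hf, f.apply_symm_apply, hy]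
  simp only [LinearMap.smul_apply, LinearMap.comp_apply, LinearEquiv.coe_coe,
    f.symm_apply_apply]

theorem Lorentzian.of_isometric [IsConjStable R] (H : h.Lorentzian) (I : Isometric h h') :
    h'.Lorentzian := by
  obtain ⟨f, hf⟩ := I
  obtain ⟨v, hv, hneg⟩ := H
  have hsq : ∀ x, h'.sq (f x) = h.sq x := fun x => sq_eq_iff.2 (by rw [hf, coe_sq])
  refine ⟨f v, by rwa [hsq], fun y hvy hy => ?_⟩
  obtain ⟨y, rfl⟩ := f.surjective y
  rw [hf] at hvy
  rw [hsq]
  exact hneg y hvy (f.map_ne_zero_iff.1 hy)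

end HermitianForm

end Isometric

section Primitive

variable {R : Subalgebra ℤ ℂ} {V : Type u} [AddCommGroup V] [Module R V]

theorem IsPrimitive.ne_zero {e : V} (he : IsPrimitive (R := R) e) : e ≠ 0 := by
  rintro rfl
  exact not_isUnit_zero (he 0 0 (zero_smul _ _).symm)

theorem isPrimitive_one_zero_zero : IsPrimitive (R := R) ((1, 0, 0) : R × R × V) :=
  fun _ x hx => IsUnit.of_mul_eq_one x.1 (congrArg Prod.fst hx).symm

end Primitive

theorem exists_linearEquiv_prod_ker_inf_ker {R V : Type*} [CommRing R] [AddCommGroup V]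
    [Module R V] {e f : V} {ψ φ : V →ₗ[R] R} (hψe : ψ e = 1) (hψf : ψ f = 0) (hφe : φ e = 0)
    (hφf : φ f = 1) :
    ∃ F : (R × R × ↥(LinearMap.ker ψ ⊓ LinearMap.ker φ)) ≃ₗ[R] V,
      ∀ x, F x = x.1 • e + x.2.1 • f + x.2.2 := by
  let π : V →ₗ[R] V := LinearMap.id - ψ.smulRight e - φ.smulRight f
  have hπ : ∀ v, π v ∈ LinearMap.ker ψ ⊓ LinearMap.ker φ := fun v => by
    simp [π, hψe, hψf, hφe, hφf]
  let F : (R × R × ↥(LinearMap.ker ψ ⊓ LinearMap.ker φ)) →ₗ[R] V :=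
    (LinearMap.toSpanSingleton R V e).coprod
      ((LinearMap.toSpanSingleton R V f).coprod (Submodule.subtype _))
  have hF : ∀ x, F x = x.1 • e + x.2.1 • f + x.2.2 := fun x => (add_assoc _ _ _).symm
  refine ⟨LinearEquiv.ofLinearMap F (ψ.prod (φ.prod (π.codRestrict _ hπ))) ?_ ?_, hF⟩
  · refine LinearMap.ext fun v => ?_
    rw [LinearMap.comp_apply, hF]
    change ψ v • e + φ v • f + (v - ψ v • e - φ v • f) = v
    abel
  · refine LinearMap.ext fun x => ?_
    have hψx : ψ (F x) = x.1 := by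
      simp [hF, hψe, hψf, LinearMap.mem_ker.1 x.2.2.2.1]
    have hφx : φ (F x) = x.2.1 := by
      simp [hF, hφe, hφf, LinearMap.mem_ker.1 x.2.2.2.2]
    refine Prod.ext hψx (Prod.ext hφx (Subtype.ext ?_))
    change F x - ψ (F x) • e - φ (F x) • f = x.2.2
    rw [hψx, hφx, hF]
    abel

namespace HermitianForm

section Hyperbolic

variable {R : Subalgebra ℤ ℂ} [IsConjStable R] {L : Type v} [AddCommGroup L] [Module R L] {α : R}

/-- The orthogonal sum of `L` with the hyperbolic plane with isotropic basis `e, f`, `e ⋆ f = α`. -/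
def hypSum (α : R) (l : HermitianForm R L) : HermitianForm R (R × R × L) where
  toFun x := (cj x.1 * α) • (LinearMap.fst R R L ∘ₗ LinearMap.snd R R (R × L)) +
    (cj x.2.1 * cj α) • LinearMap.fst R R (R × L) +
    l x.2.2 ∘ₗ LinearMap.snd R R L ∘ₗ LinearMap.snd R R (R × L)
  conj_symm x y := by
    rw [← coe_cj]
    congr 1
    simp only [LinearMap.add_apply, LinearMap.smul_apply, LinearMap.comp_apply,
      LinearMap.fst_apply, LinearMap.snd_apply, smul_eq_mul, map_add, map_mul, cj_cj, cj_apply]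
    ring

variable {l : HermitianForm R L}

theorem hypSum_apply (x y : R × R × L) :
    hypSum α l x y = cj x.1 * α * y.2.1 + cj x.2.1 * cj α * y.1 + l x.2.2 y.2.2 := rfl

theorem hypSum_inr_apply (x : L) (y : R × R × L) : hypSum α l (0, 0, x) y = l x y.2.2 := by
  simp [hypSum_apply]

theorem exists_hypSum_equiv_of_isometric {M : Type w} [AddCommGroup M] [Module R M]
    {m : HermitianForm R M} (I : Isometric l m) :
    ∃ f : (R × R × L) ≃ₗ[R] (R × R × M),
      (∀ x y, hypSum α m (f x) (f y) = hypSum α l x y) ∧ f (1, 0, 0) = (1, 0, 0) := by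
  obtain ⟨g, hg⟩ := I
  refine ⟨(LinearEquiv.refl R R).prodCongr ((LinearEquiv.refl R R).prodCongr g),
    fun x y => ?_, ?_⟩
  · simp [hypSum_apply, hg]
  · simp

theorem hypSum_perfect_iff {p : ℤ} (hα : IsModulus α p) :
    (hypSum α l).Perfect α ↔ l.Perfect α := by
  constructor <;> intro P
  · refine ⟨fun x y => ?_, fun φ => ?_⟩
    · simpa only [hypSum_inr_apply] using P.1 (0, 0, x) (0, 0, y)
    · obtain ⟨y, hy⟩ := P.2 (φ ∘ₗ LinearMap.snd R R L ∘ₗ LinearMap.snd R R (R × L))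
      refine ⟨y.2.2, LinearMap.ext fun x => ?_⟩
      simpa [hypSum_apply] using LinearMap.congr_fun hy (0, 0, x)
  · refine ⟨fun x y => ?_, fun φ => ?_⟩
    · rw [hypSum_apply]
      exact dvd_add (dvd_add ((dvd_mul_left _ _).mul_right _)
        ((hα.dvd_cj_self.mul_left _).mul_right _)) (P.1 _ _)
    · obtain ⟨m, hm⟩ := P.2 (φ ∘ₗ LinearMap.inr R R (R × L) ∘ₗ LinearMap.inr R R L)
      obtain ⟨c, hc⟩ : cj α ∣ α := by simpa using map_dvd cj hα.dvd_cj_self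
      have hφ : ∀ x, φ x = x.1 * φ (1, 0, 0) + x.2.1 * φ (0, 1, 0) + φ (0, 0, x.2.2) := fun x => by
        simp only [← smul_eq_mul, ← map_smul, ← map_add]
        simp
      refine ⟨(cj (φ (0, 1, 0)), cj c * cj (φ (1, 0, 0)), m), LinearMap.ext fun x => ?_⟩
      have hmx : l m x.2.2 = α * φ (0, 0, x.2.2) := LinearMap.congr_fun hm x.2.2
      rw [hypSum_apply, hmx, LinearMap.smul_apply, smul_eq_mul, hφ x]
      simp only [map_mul, cj_cj]
      linear_combination (-φ (1, 0, 0) * x.1) * hc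

theorem hypSum_sq (x : R × R × L) (n : ℤ) (hn : cj x.1 * α * x.2.1 + cj x.2.1 * cj α * x.1 = n) :
    (hypSum α l).sq x = n + l.sq x.2.2 :=
  sq_eq_iff.2 (by rw [hypSum_apply, hn, Int.cast_add, coe_sq])

theorem hypSum_lorentzian_iff (hα : α ≠ 0) : (hypSum α l).Lorentzian ↔ l.IsNegDef := by
  have hnrm := nrm_pos.2 hα
  have hpos : 0 < (hypSum α l).sq (1, cj α, 0) := by
    rw [hypSum_sq _ (2 * nrm α), sq_zero]
    · omega
    · push_cast
      simp only [map_one, cj_cj, coe_nrm]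
      ring
  have happly : ∀ y, hypSum α l (1, cj α, 0) y = α * (y.2.1 + cj α * y.1) := fun y => by
    rw [hypSum_apply, zero_left, map_one, cj_cj]
    ring
  rw [isNegDef_iff]
  constructor
  · intro H x hx
    have hsq : (hypSum α l).sq (0, 0, x) = l.sq x := sq_eq_iff.2 (by rw [hypSum_inr_apply, coe_sq])
    rw [← hsq]
    exact H.sq_neg hpos (by rw [happly]; simp) (by simpa using hx)
  · intro H
    refine ⟨(1, cj α, 0), hpos, fun ⟨a, b, x⟩ hy hne => ?_⟩
    obtain rfl : b = -(cj α * a) := by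
      rw [happly] at hy
      exact eq_neg_of_add_eq_zero_left ((mul_eq_zero.1 hy).resolve_left hα)
    rw [hypSum_sq _ (-(2 * (nrm α * nrm a))) (by
      push_cast
      simp only [coe_nrm, map_neg, map_mul, cj_cj]
      ring)]
    rcases eq_or_ne a 0 with rfl | ha
    · have := H x (by simpa using hne)
      rw [nrm_zero]
      dsimp only
      omega
    · have := mul_pos hnrm (nrm_pos.2 ha)
      have : l.sq x ≤ 0 := by
        rcases eq_or_ne x 0 with rfl | hx
        · exact l.sq_zero.le
        · exact (H x hx).le
      dsimp only
      omega

variable {V : Type u} [AddCommGroup V] [Module R V] {h : HermitianForm R V}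

/-- The vectors `e` and `f` form an isotropic basis of a hyperbolic plane, with `e ⋆ f = α`. -/
structure IsHyperbolicPair (h : HermitianForm R V) (α : R) (e f : V) : Prop where
  left_self : h e e = 0
  right_self : h f f = 0
  left_right : h e f = α

theorem Perfect.exists_isHyperbolicPair [IsPrincipalIdealRing R] {p : ℤ} (hα : IsModulus α p)
    (P : h.Perfect α) (N : h.Nondegenerate) {e : V} (hprim : IsPrimitive (R := R) e)
    (he : h e e = 0) : ∃ f, IsHyperbolicPair h α e f := by
  obtain ⟨g, e', f₀, hge, hf₀⟩ := P.exists_smul_eq_and_apply_eq hα.ne_zero N hprim.ne_zero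
  obtain ⟨g', hg'⟩ := (hprim g e' hge).exists_right_inv
  obtain ⟨f, hef⟩ : ∃ f, h e f = α := ⟨cj g' • f₀, by
    rw [map_smul, hge, smul_left, hf₀, smul_eq_mul, ← mul_assoc, ← map_mul, mul_comm g', hg',
      map_one, one_mul]⟩
  have hfe : h f e = cj α := by rw [← h.cj_apply, hef]
  obtain ⟨n, hn⟩ : p ∣ h.sq f := hα.dvd_intCast_iff.1 (h.coe_sq f ▸ P.1 f f)
  have hff : h f f = p * n := by rw [← coe_sq, hn, Int.cast_mul]
  refine ⟨f - (n : R) • e, he, ?_, ?_⟩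
  · simp only [sub_left, smul_left, map_sub, map_smul, smul_eq_mul, map_intCast, he, hef, hfe, hff]
    linear_combination (-n : R) * hα.add_cj
  · rw [map_sub, map_smul, he, hef, smul_zero, sub_zero]

theorem IsHyperbolicPair.exists_hypSum_equiv {p : ℤ} (hα : IsModulus α p) (P : h.Perfect α)
    {e f : V} (hp : IsHyperbolicPair h α e f) :
    ∃ (M : Submodule R V) (F : (R × R × M) ≃ₗ[R] V),
      (∀ x y, h (F x) (F y) = hypSum α (h.restrict M) x y) ∧ F (1, 0, 0) = e := by
  obtain ⟨he, hf, hef⟩ := hp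
  have hfe : h f e = cj α := by rw [← h.cj_apply, hef]
  have hα' : cj α ≠ 0 := cj_eq_zero.not.2 hα.ne_zero
  have hdvd : ∀ x, cj α ∣ h f x := fun x => by
    rw [← h.cj_apply]
    exact map_dvd cj (P.1 x f)
  obtain ⟨φ, hφ⟩ := exists_eq_smul_of_forall_dvd hα.ne_zero (P.1 e)
  obtain ⟨ψ, hψ⟩ := exists_eq_smul_of_forall_dvd hα' hdvd
  have hφe : φ e = 0 := by simpa [hφ, hα.ne_zero] using he
  have hφf : φ f = 1 := by simpa [hφ, hα.ne_zero] using hef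
  have hψe : ψ e = 1 := by simpa [hψ, hα'] using hfe
  have hψf : ψ f = 0 := by simpa [hψ, hα'] using hf
  obtain ⟨F, hF⟩ := exists_linearEquiv_prod_ker_inf_ker hψe hψf hφe hφf
  have heM : ∀ m : ↥(LinearMap.ker ψ ⊓ LinearMap.ker φ), h e m = 0 := fun m => by
    rw [hφ, LinearMap.smul_apply, LinearMap.mem_ker.1 m.2.2, smul_zero]
  have hfM : ∀ m : ↥(LinearMap.ker ψ ⊓ LinearMap.ker φ), h f m = 0 := fun m => by
    rw [hψ, LinearMap.smul_apply, LinearMap.mem_ker.1 m.2.1, smul_zero]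
  refine ⟨_, F, fun x y => ?_, by simp [hF]⟩
  simp only [hF, hypSum_apply, restrict_apply, map_add_left, smul_left, map_add, map_smul,
    smul_eq_mul, he, hf, hef, hfe, heM, hfM, h.apply_eq_zero_comm.1 (heM _),
    h.apply_eq_zero_comm.1 (hfM _)]
  ring

theorem isometric_perpQuotForm (hα : α ≠ 0) (F : (R × R × L) ≃ₗ[R] V)
    (hF : ∀ x y, h (F x) (F y) = hypSum α l x y) :
    Isometric (h.perpQuotForm (F (1, 0, 0))) l := by
  let φ : h.perp (F (1, 0, 0)) →ₗ[R] L :=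
    (LinearMap.snd R R L ∘ₗ LinearMap.snd R R (R × L)) ∘ₗ
      (F.symm : V →ₗ[R] R × R × L) ∘ₗ Submodule.subtype _
  have hperp : ∀ x, F x ∈ h.perp (F (1, 0, 0)) ↔ x.2.1 = 0 := fun x => by
    change h (F (1, 0, 0)) (F x) = 0 ↔ _
    simp [hF, hypSum_apply, zero_left, hα]
  have hker : h.lineInPerp (F (1, 0, 0)) = LinearMap.ker φ := by
    ext ⟨v, hv⟩
    obtain ⟨⟨a, b, x⟩, rfl⟩ := F.surjective v
    obtain rfl : b = 0 := (hperp _).1 hv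
    change F (a, 0, x) ∈ R ∙ F (1, 0, 0) ↔ (F.symm (F (a, 0, x))).2.2 = 0
    rw [Submodule.mem_span_singleton, F.symm_apply_apply]
    simp only [← map_smul, F.injective.eq_iff, Prod.ext_iff]
    simp [eq_comm]
  have hφ : Function.Surjective φ := fun x =>
    ⟨⟨F (0, 0, x), (hperp _).2 rfl⟩, congrArg (·.2.2) (F.symm_apply_apply (0, 0, x))⟩
  refine ⟨(Submodule.quotEquivOfEq _ _ hker).trans (φ.quotKerEquivOfSurjective hφ), fun X Y => ?_⟩
  induction X using Submodule.Quotient.induction_on with | _ x => ?_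
  induction Y using Submodule.Quotient.induction_on with | _ y => ?_
  obtain ⟨v, hv⟩ := x
  obtain ⟨w, hw⟩ := y
  obtain ⟨⟨a, b, x⟩, rfl⟩ := F.surjective v
  obtain ⟨⟨c, d, y⟩, rfl⟩ := F.surjective w
  obtain rfl : b = 0 := (hperp _).1 hv
  obtain rfl : d = 0 := (hperp _).1 hw
  change l (F.symm (F (a, 0, x))).2.2 (F.symm (F (c, 0, y))).2.2 = h (F (a, 0, x)) (F (c, 0, y))
  simp only [F.symm_apply_apply, hF, hypSum_apply, map_zero, mul_zero, zero_mul, zero_add]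

end Hyperbolic

end HermitianForm

/-! ### The rings `ℤ[ζ]` -/

section CycInt

variable {ζ : ℂ} {t : ℤ}

variable (ζ) in
/-- The generator `ζ` of `ℤ[ζ]`. -/
def gen : CycInt ζ := ⟨ζ, Algebra.subset_adjoin rfl⟩

@[simp] theorem coe_gen : (gen ζ : ℂ) = ζ := rfl

theorem exists_eq_add_mul_gen {m n : ℤ} (hsq : ζ ^ 2 = m * ζ + n) (r : CycInt ζ) :
    ∃ a b : ℤ, r = a + b * gen ζ := by
  suffices ∃ a b : ℤ, (r : ℂ) = a + b * ζ by
    obtain ⟨a, b, hab⟩ := this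
    exact ⟨a, b, Subtype.ext (by simpa using hab)⟩
  obtain ⟨r, hr⟩ := r
  dsimp only
  induction hr using Algebra.adjoin_induction with
  | mem x hx =>
    obtain rfl := Set.mem_singleton_iff.1 hx
    exact ⟨0, 1, by simp⟩
  | algebraMap a => exact ⟨a, 0, by simp⟩
  | add x y _ _ hx hy =>
    obtain ⟨a, b, rfl⟩ := hx
    obtain ⟨c, d, rfl⟩ := hy
    exact ⟨a + c, b + d, by push_cast; ring⟩
  | mul x y _ _ hx hy =>
    obtain ⟨a, b, rfl⟩ := hx
    obtain ⟨c, d, rfl⟩ := hy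
    exact ⟨a * c + b * d * n, a * d + b * c + b * d * m, by
      push_cast
      linear_combination (b * d : ℂ) * hsq⟩

theorem sq_eq_of_trace_of_norm (htr : ζ + conj ζ = t) (hnm : ζ * conj ζ = 1) :
    ζ ^ 2 = t * ζ + (-1 : ℤ) := by
  push_cast
  linear_combination ζ * htr - hnm

theorem two_mul_re_eq_of_trace (htr : ζ + conj ζ = t) : 2 * ζ.re = t := by
  simpa [two_mul] using congrArg Complex.re htr

theorem four_mul_im_sq_eq_of_trace_of_norm (htr : ζ + conj ζ = t) (hnm : ζ * conj ζ = 1) :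
    4 * ζ.im ^ 2 = 4 - (t : ℝ) ^ 2 := by
  have hnorm : ζ.re * ζ.re + ζ.im * ζ.im = 1 := by
    simpa using congrArg Complex.re hnm
  rw [← two_mul_re_eq_of_trace htr]
  linear_combination 4 * hnorm

theorem conj_mem_cycInt (htr : ζ + conj ζ = t) {z : ℂ} (hz : z ∈ CycInt ζ) :
    conj z ∈ CycInt ζ := by
  have hle : CycInt ζ ≤ (CycInt ζ).comap (starRingEnd ℂ).toIntAlgHom := by
    refine Algebra.adjoin_le (Set.singleton_subset_iff.2 ?_)
    change conj ζ ∈ CycInt ζ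
    rw [eq_sub_of_add_eq' htr]
    exact sub_mem (intCast_mem _ t) (gen ζ).2
  exact hle hz

theorem isConjStable_cycInt (htr : ζ + conj ζ = t) (hnm : ζ * conj ζ = 1) (him : ζ.im ≠ 0) :
    IsConjStable (CycInt ζ) where
  conj_mem _ := conj_mem_cycInt htr
  exists_intCast_eq z hz hreal := by
    obtain ⟨a, b, hab⟩ := exists_eq_add_mul_gen (sq_eq_of_trace_of_norm htr hnm) ⟨z, hz⟩
    have hab : z = a + b * ζ := by simpa using congrArg Subtype.val hab
    have hb : b = 0 := by
      have := Complex.conj_eq_iff_im.1 hreal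
      rw [hab] at this
      simpa [him] using this
    exact ⟨a, by simp [hab, hb]⟩

theorem isNormEuclidean_cycInt (htr : ζ + conj ζ = t) (hnm : ζ * conj ζ = 1)
    (ht : t = -1 ∨ t = 0 ∨ t = 1) : IsNormEuclidean (CycInt ζ) := by
  have him := four_mul_im_sq_eq_of_trace_of_norm htr hnm
  have him_ne : ζ.im ≠ 0 := fun h0 => by
    rw [h0] at him
    rcases ht with rfl | rfl | rfl <;> norm_num at him
  have him_le : ζ.im ^ 2 ≤ 1 := by nlinarith [sq_nonneg (t : ℝ)]
  refine { isConjStable_cycInt htr hnm him_ne with approx := fun z => ?_ }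
  let y := z.im / ζ.im
  let x := z.re - round y * ζ.re
  have hsub : z - (round x + round y * ζ) = ⟨x - round x, (y - round y) * ζ.im⟩ := by
    have hy : y * ζ.im = z.im := div_mul_cancel₀ _ him_ne
    refine Complex.ext ?_ ?_
    · simp [x]
      ring
    · simp [sub_mul, hy]
  have hx : (x - round x) ^ 2 ≤ 1 / 4 := by
    nlinarith [abs_le.1 (abs_sub_round x)]
  have hy : (y - round y) ^ 2 ≤ 1 / 4 := by
    nlinarith [abs_le.1 (abs_sub_round y)]
  refine ⟨round x + round y * gen ζ, ?_⟩
  push_cast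
  rw [coe_gen, hsub, Complex.normSq_mk]
  nlinarith [mul_le_mul hy him_le (sq_nonneg _) (by norm_num)]

theorem isModulus_one_add_gen [IsConjStable (CycInt ζ)] (htr : ζ + conj ζ = t)
    (hnm : ζ * conj ζ = 1) (ht : t = -1 ∨ t = 0 ∨ t = 1) :
    IsModulus (1 + gen ζ) (2 + t) where
  eq_one_or_two_or_three := by omega
  mul_cj := Subtype.ext (by
    simp only [map_add, map_one, MulMemClass.coe_mul, AddMemClass.coe_add, OneMemClass.coe_one,
      coe_gen, coe_cj, SubringClass.coe_intCast]
    push_cast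
    linear_combination htr + hnm)
  add_cj := Subtype.ext (by
    simp only [map_add, map_one, AddMemClass.coe_add, OneMemClass.coe_one, coe_gen, coe_cj,
      SubringClass.coe_intCast]
    push_cast
    linear_combination htr)
  exists_dvd_sub_intCast c := by
    obtain ⟨a, b, rfl⟩ := exists_eq_add_mul_gen (sq_eq_of_trace_of_norm htr hnm) c
    exact ⟨a - b, b, by push_cast; ring⟩

end CycInt

theorem exists_sq_eq_of_isPrimitiveRoot {K : Type*} [CommRing K] [IsDomain K] {k : ℕ}
    (hk : k = 3 ∨ k = 4 ∨ k = 6) {ζ : K} (hζ : IsPrimitiveRoot ζ k) :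
    ∃ t : ℤ, (t = -1 ∨ t = 0 ∨ t = 1) ∧ ζ ^ 2 = t * ζ - 1 := by
  have hroot := hζ.isRoot_cyclotomic (by omega)
  rcases hk with rfl | rfl | rfl
  · have heq : ζ ^ 2 + ζ + 1 = 0 := by simpa [Polynomial.cyclotomic_three] using hroot
    exact ⟨-1, by simp, by push_cast; linear_combination heq⟩
  · have hfour : Polynomial.cyclotomic 4 K = 1 + Polynomial.X ^ 2 := by
      simpa [Finset.sum_range_succ] using
        Polynomial.cyclotomic_prime_pow_eq_geom_sum (R := K) (n := 1) Nat.prime_two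
    have heq : 1 + ζ ^ 2 = 0 := by simpa [hfour] using hroot
    exact ⟨0, by simp, by push_cast; linear_combination heq⟩
  · have heq : ζ ^ 2 - ζ + 1 = 0 := by simpa [Polynomial.cyclotomic_six] using hroot
    exact ⟨1, by simp, by push_cast; linear_combination heq⟩

theorem exists_trace_and_norm_of_isPrimitiveRoot {k : ℕ} (hk : k = 3 ∨ k = 4 ∨ k = 6) {ζ : ℂ}
    (hζ : IsPrimitiveRoot ζ k) :
    ∃ t : ℤ, (t = -1 ∨ t = 0 ∨ t = 1) ∧ ζ + conj ζ = t ∧ ζ * conj ζ = 1 := by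
  obtain ⟨t, ht, hsq⟩ := exists_sq_eq_of_isPrimitiveRoot hk hζ
  have hnm : ζ * conj ζ = 1 := by
    rw [Complex.mul_conj', hζ.norm'_eq_one (by omega), Complex.ofReal_one, one_pow]
  exact ⟨t, ht, by linear_combination conj ζ * hsq + (t - ζ) * hnm, hnm⟩

namespace HermitianForm

/-! ### Modularity and signature over `ℂ` -/

section Complexify

variable {R : Subalgebra ℤ ℂ} {V : Type u} [AddCommGroup V] [Module R V] (h : HermitianForm R V)

theorem complexify_tmul_right (w : ℂ ⊗[R] V) (c : ℂ) (y : V) :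
    h.complexify w (c ⊗ₜ y) = c * conj (h.extendRight y w) := by
  simp [complexify, functional]

theorem complexify_one_tmul (x y : V) : h.complexify (1 ⊗ₜ x) (1 ⊗ₜ y) = (h x y : ℂ) := by
  simp [complexify_tmul]

/-- The form `complexify`, bundled as a sesquilinear map. -/
noncomputable def complexifySesq : (ℂ ⊗[R] V) →ₗ⋆[ℂ] (ℂ ⊗[R] V) →ₗ[ℂ] ℂ where
  toFun := h.complexify
  map_add' w w' := TensorProduct.AlgebraTensorModule.curry_injective <| by
    ext y
    simp [complexify_tmul_right]
  map_smul' a w := TensorProduct.AlgebraTensorModule.curry_injective <| by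
    ext y
    simp [complexify_tmul_right]

theorem complexify_sub_left (w w' : ℂ ⊗[R] V) :
    h.complexify (w - w') = h.complexify w - h.complexify w' := map_sub h.complexifySesq w w'

theorem complexify_smul_left (a : ℂ) (w : ℂ ⊗[R] V) :
    h.complexify (a • w) = conj a • h.complexify w := map_smulₛₗ h.complexifySesq a w

theorem complexify_sum_left {ι : Type*} (s : Finset ι) (w : ι → ℂ ⊗[R] V) :
    h.complexify (∑ i ∈ s, w i) = ∑ i ∈ s, h.complexify (w i) := map_sum h.complexifySesq w s

variable {h}

theorem extendRight_of_eq_smul_coord {ι : Type*} {b : Module.Basis ι R V} {α : R} {y : V} {i : ι}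
    (hy : h y = α • b.coord i) (w : ℂ ⊗[R] V) :
    h.extendRight y w = α * (Algebra.TensorProduct.basis ℂ b).repr w i := by
  induction w using TensorProduct.induction_on with
  | zero => simp
  | tmul c z =>
    rw [extendRight_tmul, hy, Algebra.TensorProduct.basis_repr_tmul]
    simp
    ring
  | add w w' hw hw' => rw [map_add, hw, hw', map_add, Finsupp.add_apply, mul_add]

theorem Perfect.eq_zero_of_complexify_eq_zero [Module.Free R V] {α : R} (hα : α ≠ 0)
    (P : h.Perfect α) {w : ℂ ⊗[R] V} (hw : ∀ x, h.complexify w (1 ⊗ₜ x) = 0) : w = 0 := by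
  let b := Module.Free.chooseBasis R V
  refine (Algebra.TensorProduct.basis ℂ b).ext_elem fun i => ?_
  obtain ⟨y, hy⟩ := P.2 (b.coord i)
  have hzero := hw y
  rw [complexify_tmul_right, one_mul, extendRight_of_eq_smul_coord hy, map_mul] at hzero
  simpa [hα] using hzero

variable [IsConjStable R]

theorem Nondegenerate.exists_complexify_eq [Module.Free R V] [Module.Finite R V]
    (N : h.Nondegenerate) (φ : V →ₗ[R] R) : ∃ w, ∀ x, h.complexify w (1 ⊗ₜ x) = (φ x : ℂ) := by
  classical
  let b := Module.Free.chooseBasis R V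
  obtain ⟨y, hy⟩ := exists_eq_det_gram_smul (h := h) b φ
  have hd : ((h.gram b).det : ℂ) ≠ 0 := by simpa using N.det_gram_ne_zero b
  refine ⟨(conj ((h.gram b).det : ℂ))⁻¹ • (1 ⊗ₜ y), fun x => ?_⟩
  rw [complexify_smul_left, LinearMap.smul_apply, complexify_one_tmul, hy, map_inv₀,
    Complex.conj_conj]
  exact inv_mul_cancel_left₀ hd _

variable {α : R} {p : ℤ}

theorem IsModular.perfect [Module.Free R V] [Module.Finite R V] (hα : IsModulus α p)
    (N : h.Nondegenerate) (M : h.IsModular α) : h.Perfect α := by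
  constructor
  · intro x y
    obtain ⟨w, hw, hwx : (α : ℂ) • w = 1 ⊗ₜ x⟩ :
        (1 : ℂ) ⊗ₜ[R] x ∈ (fun w => (α : ℂ) • w) '' h.dual := M ▸ ⟨x, rfl⟩
    refine hα.dvd_cj_self.trans ⟨⟨_, hw y⟩, Subtype.ext ?_⟩
    rw [← complexify_one_tmul, ← hwx, complexify_smul_left]
    rfl
  · intro φ
    obtain ⟨c, hc⟩ : cj α ∣ α := by simpa using map_dvd cj hα.dvd_cj_self
    obtain ⟨w, hw⟩ := N.exists_complexify_eq (c • φ)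
    obtain ⟨y, hy : 1 ⊗ₜ y = (α : ℂ) • w⟩ :
        (α : ℂ) • w ∈ Set.range (fun y : V => (1 : ℂ) ⊗ₜ[R] y) :=
      M ▸ ⟨w, fun x => hw x ▸ SetLike.coe_mem _, rfl⟩
    refine ⟨y, LinearMap.ext fun x => Subtype.ext ?_⟩
    have hcφ : (α • φ) x = cj α * (c • φ) x := by
      simp only [LinearMap.smul_apply, smul_eq_mul]
      linear_combination φ x * hc
    rw [← complexify_one_tmul, hy, complexify_smul_left, LinearMap.smul_apply, hw, hcφ]
    rfl

theorem Perfect.isModular [Module.Free R V] (hα : IsModulus α p) (P : h.Perfect α) :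
    h.IsModular α := by
  have hα0 : (α : ℂ) ≠ 0 := by simpa using hα.ne_zero
  refine Set.Subset.antisymm ?_ ?_
  · rintro _ ⟨y, rfl⟩
    refine ⟨(α : ℂ)⁻¹ • (1 ⊗ₜ y), fun x => ?_, smul_inv_smul₀ hα0 _⟩
    obtain ⟨a, ha⟩ : cj α ∣ h y x :=
      Dvd.dvd.trans (by simpa using map_dvd cj hα.dvd_cj_self) (P.1 y x)
    have hcj : conj (α : ℂ) ≠ 0 := (map_ne_zero _).2 hα0
    rw [complexify_smul_left, LinearMap.smul_apply, complexify_one_tmul, ha, map_inv₀,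
      smul_eq_mul, MulMemClass.coe_mul, coe_cj, inv_mul_cancel_left₀ hcj]
    exact a.2
  · rintro _ ⟨w, hw, rfl⟩
    let φ : V →ₗ[R] R :=
      { toFun x := ⟨_, hw x⟩
        map_add' x y := Subtype.ext (by simp [TensorProduct.tmul_add])
        map_smul' a x := Subtype.ext (by simp [TensorProduct.tmul_smul, Algebra.smul_def]) }
    obtain ⟨d, hd⟩ := hα.dvd_cj_self
    obtain ⟨y, hy⟩ := P.2 (d • φ)
    have hdφ : ∀ x, (α • d • φ) x = cj α * φ x := fun x => by
      simp only [LinearMap.smul_apply, smul_eq_mul]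
      linear_combination -φ x * hd
    refine ⟨y, sub_eq_zero.1 (P.eq_zero_of_complexify_eq_zero hα.ne_zero fun x => ?_)⟩
    rw [complexify_sub_left, LinearMap.sub_apply, complexify_one_tmul, complexify_smul_left, hy,
      hdφ]
    exact sub_self _

end Complexify

end HermitianForm

theorem eq_zero_of_mul_eq_inner_of_norm_lt {𝕜 E : Type*} [RCLike 𝕜] [NormedAddCommGroup E]
    [InnerProductSpace 𝕜 E] {a b : 𝕜} {x y : E} (horth : conj a * b = inner 𝕜 x y)
    (hx : ‖x‖ < ‖a‖) (hy : ‖y‖ ≤ ‖b‖) : b = 0 ∧ y = 0 := by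
  have hle : ‖a‖ * ‖b‖ ≤ ‖x‖ * ‖b‖ := calc
    ‖a‖ * ‖b‖ = ‖inner 𝕜 x y‖ := by rw [← horth, norm_mul, RCLike.norm_conj]
    _ ≤ ‖x‖ * ‖y‖ := norm_inner_le_norm x y
    _ ≤ ‖x‖ * ‖b‖ := by gcongr
  have hb : ‖b‖ = 0 := by
    by_contra hne
    exact hx.not_ge (le_of_mul_le_mul_right hle ((norm_nonneg b).lt_of_ne' hne))
  exact ⟨norm_eq_zero.1 hb, norm_le_zero_iff.1 (hb ▸ hy)⟩

open Filter Topology in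
theorem exists_tendsto_div_natCast {R : Subalgebra ℤ ℂ} [IsNormEuclidean R] (z : ℂ) :
    ∃ r : ℕ → R, Tendsto (fun n => (r n : ℂ) / n) atTop (𝓝 z) := by
  choose r hr using fun n : ℕ => IsNormEuclidean.approx (R := R) (n * z)
  refine ⟨r, tendsto_iff_norm_sub_tendsto_zero.2 <|
    squeeze_zero' (.of_forall fun n => norm_nonneg _) ?_ tendsto_one_div_atTop_nhds_zero_nat⟩
  filter_upwards [eventually_gt_atTop 0] with n hn
  have hr_le : ‖(n : ℂ) * z - r n‖ ≤ 1 := by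
    have := hr n
    rw [Complex.normSq_eq_norm_sq] at this
    nlinarith [norm_nonneg ((n : ℂ) * z - r n)]
  have hn0 : (n : ℂ) ≠ 0 := Nat.cast_ne_zero.2 hn.ne'
  rw [norm_sub_rev, show z - r n / n = (n * z - r n) / n by field_simp, norm_div,
    Complex.norm_natCast]
  gcongr

namespace HermitianForm

section Signature

variable {R : Subalgebra ℤ ℂ} {V : Type u} [AddCommGroup V] [Module R V] {h : HermitianForm R V}

theorem IsNegDef.nondegenerate (H : h.IsNegDef) : h.Nondegenerate := fun x hx => by
  by_contra hne
  simpa [hx] using H x hne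

theorem HasSignature.finrank_eq [Module.Free R V] {r s : ℕ} (H : h.HasSignature r s) :
    Module.finrank R V = r + s := by
  obtain ⟨c, -⟩ := H
  rw [← Module.finrank_baseChange (R := ℂ), Module.finrank_eq_card_basis c]
  simp

theorem HasSignature.exists_linearEquiv {s : ℕ} (H : h.HasSignature 1 s) :
    ∃ F : (ℂ ⊗[R] V) ≃ₗ[ℂ] ℂ × EuclideanSpace ℂ (Fin s), ∀ w z,
      h.complexify w z = conj (F w).1 * (F z).1 - inner ℂ (F w).2 (F z).2 := by
  obtain ⟨c, hc⟩ := H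
  refine ⟨c.equivFun ≪≫ₗ LinearEquiv.sumArrowLequivProdArrow (Fin 1) (Fin s) ℂ ℂ ≪≫ₗ
    (LinearEquiv.funUnique (Fin 1) ℂ ℂ).prodCongr (WithLp.linearEquiv 2 ℂ _).symm,
    fun w z => ?_⟩
  conv_lhs => rw [← c.sum_repr w, ← c.sum_repr z]
  simp only [complexify_sum_left, complexify_smul_left, LinearMap.sum_apply, LinearMap.smul_apply,
    map_sum, map_smul, hc, smul_eq_mul, Matrix.diagonal_apply]
  simp [Fintype.sum_sum_type, PiLp.inner_apply, sub_eq_add_neg, mul_comm]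

open Filter Topology in
/-- The positive cone is open, so it contains a rational multiple of a lattice vector. -/
theorem exists_sq_pos [IsNormEuclidean R] [Module.Free R V] [Module.Finite R V]
    {w : ℂ ⊗[R] V} (hw : 0 < (h.complexify w w).re) : ∃ v, 0 < h.sq v := by
  let b := Module.Free.chooseBasis R V
  let B := Algebra.TensorProduct.basis ℂ b
  let q (d : Module.Free.ChooseBasisIndex R V → ℂ) : ℝ :=
    (h.complexify (B.equivFun.symm d) (B.equivFun.symm d)).re
  have hq_cont : Continuous q := by
    simp only [q, B.equivFun_symm_apply, complexify_sum_left, complexify_smul_left,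
      LinearMap.sum_apply, LinearMap.smul_apply, map_sum, map_smul, smul_eq_mul]
    fun_prop
  have hq_smul : ∀ (a : ℂ) d, q (a • d) = Complex.normSq a * q d := fun a d => by
    simp only [q, map_smul, complexify_smul_left, LinearMap.smul_apply, smul_eq_mul]
    rw [← mul_assoc, Complex.mul_conj, Complex.re_ofReal_mul]
  have hq_coe : ∀ r : Module.Free.ChooseBasisIndex R V → R,
      q (fun i => r i) = h.sq (∑ i, r i • b i) := fun r => by
    have hr : B.equivFun.symm (fun i => (r i : ℂ)) = 1 ⊗ₜ ∑ i, r i • b i := by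
      simp [B.equivFun_symm_apply, B, TensorProduct.tmul_sum, TensorProduct.smul_tmul',
        TensorProduct.tmul_smul, Algebra.smul_def]
    rw [cast_sq, ← complexify_one_tmul, ← hr]
  choose r hr using fun i => exists_tendsto_div_natCast (R := R) (B.equivFun w i)
  have hq_pos : 0 < q (B.equivFun w) := by simpa only [q, B.equivFun.symm_apply_apply] using hw
  have hlim : Tendsto (fun n : ℕ => q fun i => r i n / n) atTop (𝓝 (q (B.equivFun w))) :=
    (hq_cont.tendsto _).comp (tendsto_pi_nhds.2 hr)
  obtain ⟨n, hn, hn0⟩ := ((hlim.eventually_const_lt hq_pos).and (eventually_gt_atTop 0)).exists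
  refine ⟨∑ i, r i n • b i, ?_⟩
  have hn0 : (n : ℂ) ≠ 0 := Nat.cast_ne_zero.2 hn0.ne'
  have hscale : (fun i => (r i n : ℂ)) = (n : ℂ) • fun i => (r i n : ℂ) / n :=
    funext fun i => (mul_div_cancel₀ _ hn0).symm
  have := mul_pos (Complex.normSq_pos.2 hn0) hn
  rwa [← hq_smul, ← hscale, hq_coe, Int.cast_pos] at this

theorem HasSignature.lorentzian [IsNormEuclidean R] [Module.Free R V] [Module.Finite R V] {s : ℕ}
    (H : h.HasSignature 1 s) : h.Lorentzian := by
  obtain ⟨F, hF⟩ := H.exists_linearEquiv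
  have hsq : ∀ x : V, (h.sq x : ℝ) = ‖(F (1 ⊗ₜ x)).1‖ ^ 2 - ‖(F (1 ⊗ₜ x)).2‖ ^ 2 := fun x => by
    rw [cast_sq, ← complexify_one_tmul, hF, Complex.sub_re, Complex.conj_mul',
      inner_self_eq_norm_sq_to_K]
    norm_cast
  obtain ⟨v, hv⟩ := exists_sq_pos (h := h) (w := F.symm (1, 0)) (by simp [hF])
  refine ⟨v, hv, fun y hy hne => ?_⟩
  by_contra! hy_nonneg
  have hv_lt : ‖(F (1 ⊗ₜ v)).2‖ < ‖(F (1 ⊗ₜ v)).1‖ :=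
    lt_of_pow_lt_pow_left₀ 2 (norm_nonneg _) (sub_pos.1 (hsq v ▸ Int.cast_pos.2 hv))
  have hy_le : ‖(F (1 ⊗ₜ y)).2‖ ≤ ‖(F (1 ⊗ₜ y)).1‖ :=
    le_of_sq_le_sq (sub_nonneg.1 (hsq y ▸ Int.cast_nonneg hy_nonneg)) (norm_nonneg _)
  have horth : conj (F (1 ⊗ₜ v)).1 * (F (1 ⊗ₜ y)).1 = inner ℂ (F (1 ⊗ₜ v)).2 (F (1 ⊗ₜ y)).2 := by
    rw [← sub_eq_zero, ← hF, complexify_one_tmul, hy, ZeroMemClass.coe_zero]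
  obtain ⟨hfst, hsnd⟩ := eq_zero_of_mul_eq_inner_of_norm_lt horth hv_lt hy_le
  refine hne (Module.Flat.tensorProduct_mk_injective R V ℂ (F.injective ?_))
  rw [map_zero, map_zero]
  exact Prod.ext hfst hsnd

end Signature

end HermitianForm

theorem exists_equiv_quotient_of_rel {A B : Type*} (S : Setoid A) (T : Setoid B)
    (r : A → B → Prop) (hleft : ∀ a, ∃ b, r a b) (hright : ∀ b, ∃ a, r a b)
    (hrel : ∀ {a a' b b'}, r a b → r a' b' → (S a a' ↔ T b b'))
    (htrans : ∀ {a b b'}, r a b → T b b' → r a b') :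
    ∃ Φ : Quotient S ≃ Quotient T, ∀ a b, Φ (Quotient.mk _ a) = Quotient.mk _ b ↔ r a b := by
  choose f hf using hleft
  let φ : Quotient S → Quotient T := Quotient.map f fun a a' haa => (hrel (hf a) (hf a')).1 haa
  have hφ : ∀ a b, φ (Quotient.mk _ a) = Quotient.mk _ b ↔ r a b := fun a b =>
    ⟨fun heq => htrans (hf a) (Quotient.exact heq),
      fun hab => Quotient.sound ((hrel (hf a) hab).1 (S.refl a))⟩
  refine ⟨Equiv.ofBijective φ ⟨fun x y => ?_, fun y => ?_⟩, hφ⟩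
  · induction x, y using Quotient.inductionOn₂ with | _ a a' => ?_
    exact fun haa => Quotient.sound ((hrel (hf a) (hf a')).2 (Quotient.exact haa))
  · induction y using Quotient.inductionOn with | _ b => ?_
    obtain ⟨a, hab⟩ := hright b
    exact ⟨Quotient.mk _ a, (hφ a b).2 hab⟩

namespace HermitianForm

/-! ### The lattices `e^⊥ / e` -/

section Transport

variable {R : Subalgebra ℤ ℂ} {V : Type u} [AddCommGroup V] [Module R V]
  {W : Type v} [AddCommGroup W] [Module R W]

/-- The form on `W` that makes a linear equivalence `V ≃ W` an isometry. -/
def transport (h : HermitianForm R V) (E : V ≃ₗ[R] W) : HermitianForm R W where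
  toFun x := h (E.symm x) ∘ₗ (E.symm : W →ₗ[R] V)
  conj_symm x y := h.conj_symm (E.symm x) (E.symm y)

theorem isometric_transport (h : HermitianForm R V) (E : V ≃ₗ[R] W) :
    Isometric h (h.transport E) :=
  ⟨E, fun x y => congrArg₂ (fun x y => (h x y : R)) (E.symm_apply_apply x) (E.symm_apply_apply y)⟩

theorem exists_negDefModularLattice_isometric [IsConjStable R] [Module.Free R V]
    [Module.Finite R V] {h : HermitianForm R V} {α : R} {p : ℤ} {n : ℕ} (hα : IsModulus α p)
    (hrank : Module.finrank R V = n) (H : h.IsNegDef) (P : h.Perfect α) :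
    ∃ L : NegDefModularLattice.{v} R α n, Isometric h L.form := by
  let E : V ≃ₗ[R] ULift.{v} (Fin n → R) :=
    (Module.finBasisOfFinrankEq R V hrank).equivFun ≪≫ₗ ULift.moduleEquiv.symm
  have I := isometric_transport h E
  exact ⟨{
    carrier := ULift.{v} (Fin n → R)
    form := h.transport E
    rank_eq := E.finrank_eq.symm.trans hrank
    negDef := H.of_isometric I
    modular := (P.of_isometric I).isModular hα }, I⟩

end Transport

section PerpQuot

variable {R : Subalgebra ℤ ℂ} [IsConjStable R] [IsPrincipalIdealRing R]
  {V : Type u} [AddCommGroup V] [Module R V] {h : HermitianForm R V} {α : R} {p : ℤ} {e : V}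

theorem exists_hypSum_equiv_of_mem_primitiveIsotropic (hα : IsModulus α p) (P : h.Perfect α)
    (N : h.Nondegenerate) (he : e ∈ h.primitiveIsotropic) :
    ∃ (M : Submodule R V) (F : (R × R × M) ≃ₗ[R] V),
      (∀ x y, h (F x) (F y) = hypSum α (h.restrict M) x y) ∧ F (1, 0, 0) = e := by
  obtain ⟨f, hp⟩ := P.exists_isHyperbolicPair hα N he.1 he.2
  exact hp.exists_hypSum_equiv hα P

theorem perfect_perpQuotForm (hα : IsModulus α p) (P : h.Perfect α) (N : h.Nondegenerate)
    (he : e ∈ h.primitiveIsotropic) : (h.perpQuotForm e).Perfect α := by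
  obtain ⟨M, F, hF, rfl⟩ := exists_hypSum_equiv_of_mem_primitiveIsotropic hα P N he
  exact ((hypSum_perfect_iff hα).1 (P.of_isometric (Isometric.symm ⟨F, hF⟩))).of_isometric
    (isometric_perpQuotForm hα.ne_zero F hF).symm

theorem isNegDef_perpQuotForm (hα : IsModulus α p) (P : h.Perfect α) (H : h.Lorentzian)
    (he : e ∈ h.primitiveIsotropic) : (h.perpQuotForm e).IsNegDef := by
  obtain ⟨M, F, hF, rfl⟩ := exists_hypSum_equiv_of_mem_primitiveIsotropic hα P H.nondegenerate he
  exact ((hypSum_lorentzian_iff hα.ne_zero).1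
    (H.of_isometric (Isometric.symm ⟨F, hF⟩))).of_isometric
      (isometric_perpQuotForm hα.ne_zero F hF).symm

theorem free_perpQuot [Module.Free R V] [Module.Finite R V] (hα : IsModulus α p)
    (P : h.Perfect α) (N : h.Nondegenerate) (he : e ∈ h.primitiveIsotropic) :
    Module.Free R (h.PerpQuot e) := by
  obtain ⟨M, F, hF, rfl⟩ := exists_hypSum_equiv_of_mem_primitiveIsotropic hα P N he
  obtain ⟨f, -⟩ := isometric_perpQuotForm hα.ne_zero F hF
  exact .of_equiv f.symm

theorem finrank_perpQuot_add_two [Module.Free R V] [Module.Finite R V] (hα : IsModulus α p)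
    (P : h.Perfect α) (N : h.Nondegenerate) (he : e ∈ h.primitiveIsotropic) :
    Module.finrank R (h.PerpQuot e) + 2 = Module.finrank R V := by
  obtain ⟨M, F, hF, rfl⟩ := exists_hypSum_equiv_of_mem_primitiveIsotropic hα P N he
  obtain ⟨f, -⟩ := isometric_perpQuotForm hα.ne_zero F hF
  rw [f.finrank_eq, ← F.finrank_eq, Module.finrank_prod, Module.finrank_prod, Module.finrank_self]
  ring

theorem orbitRel_primitiveIsotropic_iff (hα : IsModulus α p) (P : h.Perfect α)
    (N : h.Nondegenerate) (e e' : h.primitiveIsotropic) :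
    MulAction.orbitRel h.isometryGroup h.primitiveIsotropic e e' ↔
      Isometric (h.perpQuotForm e.1) (h.perpQuotForm e'.1) := by
  obtain ⟨e, he⟩ := e
  obtain ⟨e', he'⟩ := e'
  rw [MulAction.orbitRel_apply, MulAction.mem_orbit_iff]
  obtain ⟨M', F', hF', rfl⟩ := exists_hypSum_equiv_of_mem_primitiveIsotropic hα P N he'
  have I' := isometric_perpQuotForm hα.ne_zero F' hF'
  constructor
  · rintro ⟨⟨g, hg⟩, hge⟩
    obtain rfl : g (F' (1, 0, 0)) = e := congrArg Subtype.val hge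
    exact (isometric_perpQuotForm hα.ne_zero (F' ≪≫ₗ g)
      fun x y => (hg _ _).trans (hF' x y)).trans I'.symm
  · intro J
    obtain ⟨M, F, hF, rfl⟩ := exists_hypSum_equiv_of_mem_primitiveIsotropic hα P N he
    have I := isometric_perpQuotForm hα.ne_zero F hF
    obtain ⟨k, hk, hk1⟩ :=
      exists_hypSum_equiv_of_isometric (α := α) ((I'.symm.trans J.symm).trans I)
    refine ⟨⟨F'.symm ≪≫ₗ k ≪≫ₗ F, fun x y => ?_⟩, Subtype.ext ?_⟩
    · simp only [LinearEquiv.trans_apply]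
      rw [hF, hk, ← hF', F'.apply_symm_apply, F'.apply_symm_apply]
    · change F (k (F'.symm (F' (1, 0, 0)))) = F (1, 0, 0)
      rw [F'.symm_apply_apply, hk1]

end PerpQuot

theorem exists_isometric_perpQuotForm {R : Subalgebra ℤ ℂ} [IsNormEuclidean R]
    {V : Type u} [AddCommGroup V] [Module R V] [Module.Free R V] [Module.Finite R V]
    {h : HermitianForm R V} {L : Type v} [AddCommGroup L] [Module R L] [Module.Free R L]
    [Module.Finite R L] {l : HermitianForm R L} {α : R} {p : ℤ} (hα : IsModulus α p)
    (P : h.Perfect α) (H : h.Lorentzian) (Pl : l.Perfect α) (Hl : l.IsNegDef)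
    (hrank : Module.finrank R L + 2 = Module.finrank R V) :
    ∃ e : h.primitiveIsotropic, Isometric (h.perpQuotForm e.1) l := by
  have hrank' : Module.finrank R (R × R × L) = Module.finrank R V := by
    rw [Module.finrank_prod, Module.finrank_prod, Module.finrank_self]
    omega
  obtain ⟨F, hF⟩ := isometric_of_finrank_eq hα ((hypSum_lorentzian_iff hα.ne_zero).2 Hl)
    ((hypSum_perfect_iff hα).2 Pl) H P hrank' (by omega)
  refine ⟨⟨F (1, 0, 0), fun a x hx => ?_, by simp [hF, hypSum_apply]⟩,
    isometric_perpQuotForm hα.ne_zero F hF⟩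
  refine isPrimitive_one_zero_zero (V := L) a (F.symm x) ?_
  rw [← map_smul, ← hx, F.symm_apply_apply]

theorem exists_isotropicOrbits_equiv_isometryClasses {R : Subalgebra ℤ ℂ}
    [IsNormEuclidean R] {V : Type u} [AddCommGroup V] [Module R V] [Module.Free R V]
    [Module.Finite R V] {h : HermitianForm R V} {α : R} {p : ℤ} {n : ℕ} (hα : IsModulus α p)
    (P : h.Perfect α) (H : h.Lorentzian) (hrank : Module.finrank R V = n + 2) :
    ∃ Φ : h.IsotropicOrbits ≃ IsometryClasses.{v} R (α : ℂ) n,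
      ∀ (e : h.primitiveIsotropic) (L : NegDefModularLattice.{v} R (α : ℂ) n),
        Φ (Quotient.mk _ e) = Quotient.mk _ L ↔ Isometric (h.perpQuotForm e.1) L.form := by
  have N := H.nondegenerate
  have hsurj (L : NegDefModularLattice.{v} R (α : ℂ) n) :
      ∃ e : h.primitiveIsotropic, Isometric (h.perpQuotForm e.1) L.form :=
    exists_isometric_perpQuotForm hα P H (L.modular.perfect hα L.negDef.nondegenerate) L.negDef
      (by rw [L.rank_eq, hrank])
  have hexists (e : h.primitiveIsotropic) :
      ∃ L : NegDefModularLattice.{v} R (α : ℂ) n, Isometric (h.perpQuotForm e.1) L.form := by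
    have := free_perpQuot hα P N e.2
    have hperp := finrank_perpQuot_add_two hα P N e.2
    exact exists_negDefModularLattice_isometric hα (by omega) (isNegDef_perpQuotForm hα P H e.2)
      (perfect_perpQuotForm hα P N e.2)
  exact exists_equiv_quotient_of_rel (MulAction.orbitRel h.isometryGroup h.primitiveIsotropic)
    (isometrySetoid.{v} R (α : ℂ) n) (fun e L => Isometric (h.perpQuotForm e.1) L.form)
    hexists hsurj
    (fun I I' => (orbitRel_primitiveIsotropic_iff hα P N _ _).trans
      ⟨fun J => (I.symm.trans J).trans I', fun J => (I.trans J).trans I'.symm⟩)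
    Isometric.trans

end HermitianForm

end HermLat

theorem mainTheorem10 (k : ℕ) (hk : k = 3 ∨ k = 4 ∨ k = 6) (ζ : ℂ) (hζ : IsPrimitiveRoot ζ k)
    (s : ℕ) (hs : 1 ≤ s)
    (Λ : Type u) [AddCommGroup Λ] [Module (HermLat.CycInt ζ) Λ]
    [Module.Free (HermLat.CycInt ζ) Λ] [Module.Finite (HermLat.CycInt ζ) Λ]
    (h : HermLat.HermitianForm (HermLat.CycInt ζ) Λ)
    (hsig : h.HasSignature 1 s) (hmod : h.IsModular (1 + ζ)) :
    (∀ e ∈ h.primitiveIsotropic,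
      Module.Free (HermLat.CycInt ζ) (h.PerpQuot e) ∧
      Module.Finite (HermLat.CycInt ζ) (h.PerpQuot e) ∧
      Module.finrank (HermLat.CycInt ζ) (h.PerpQuot e) = s - 1 ∧
      (h.perpQuotForm e).IsNegDef ∧
      (h.perpQuotForm e).IsModular (1 + ζ)) ∧
    ∃ Φ : h.IsotropicOrbits ≃ HermLat.IsometryClasses.{v} (HermLat.CycInt ζ) (1 + ζ) (s - 1),
      ∀ (e : h.primitiveIsotropic)
        (L : HermLat.NegDefModularLattice.{v} (HermLat.CycInt ζ) (1 + ζ) (s - 1)),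
        Φ (Quotient.mk _ e) = Quotient.mk _ L ↔
          HermLat.Isometric (h.perpQuotForm e.1) L.form := by
  obtain ⟨t, ht, htr, hnm⟩ := HermLat.exists_trace_and_norm_of_isPrimitiveRoot hk hζ
  have := HermLat.isNormEuclidean_cycInt htr hnm ht
  obtain ⟨α, hα, hαζ⟩ : ∃ α : HermLat.CycInt ζ, HermLat.IsModulus α (2 + t) ∧ (α : ℂ) = 1 + ζ :=
    ⟨_, HermLat.isModulus_one_add_gen htr hnm ht, rfl⟩
  rw [← hαζ] at hmod ⊢
  have H := hsig.lorentzian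
  have N := H.nondegenerate
  have P := HermLat.HermitianForm.IsModular.perfect hα N hmod
  have hrank : Module.finrank (HermLat.CycInt ζ) Λ = s - 1 + 2 := by
    rw [hsig.finrank_eq]
    omega
  refine ⟨fun e he => ?_,
    HermLat.HermitianForm.exists_isotropicOrbits_equiv_isometryClasses hα P H hrank⟩
  have hfree := HermLat.HermitianForm.free_perpQuot hα P N he
  have hadd := HermLat.HermitianForm.finrank_perpQuot_add_two hα P N he
  exact ⟨hfree, inferInstance, add_right_cancel (hadd.trans hrank),
    HermLat.HermitianForm.isNegDef_perpQuotForm hα P H he,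
    (HermLat.HermitianForm.perfect_perpQuotForm hα P N he).isModular hα⟩
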